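/- Let $d\ge 2$ and let $\mathbf k=(k_1,\dots,k_{d+1})$ be a sequence of positive integers, not all equal; indices are read cyclically modulo $d+1$. **Setting.** Let $V=\{x\in\mathbb R^{d+1}: x_1+\dots+x_{d+1}=0\}$ and let $\widetilde w_i=e_i-\frac1{d+1}\sum_{j}e_j\in V$. The hyperplanes $\{x\in V: x_j-x_i=m\}$ ($i<j$, $m\in\mathbb Z$) decompose $V$ into an infinite simplicial complex $\widetilde{\mathcal C}_d$, whose vertex set is the weight lattice $\widetilde{\mathcal L}_d=\{\sum_i a_i\widetilde w_i: a\in\mathbb Z^{d+1}\}$. Let $M_{\mathbf k}$ be the $(d+1)\times(d+1)$ integer matrix whose $i$-th row has the entry $k_i+1$ in column $i$, the entry $-k_{i+1}$ in column $i+1$ (cyclically), and zeros elsewhere, and let $\widetilde{\mathcal L}_{\mathbf k}=\{\sum_i a_i\widetilde w_i: a=bM_{\mathbf k},\ b\in\mathbb Z^{d+1}\}$. The complex $T_{\mathbf k}=\widetilde{\mathcal C}_d/\widetilde{\mathcal L}_{\mathbf k}$ is the simplicial complex of the classes of faces of $\widetilde{\mathcal C}_d$ up to translation by vectors of $\widetilde{\mathcal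 L}_{\mathbf k}$, where one class is contained in another if some representative of the first is contained in some representative of the second. An automorphism of $T_{\mathbf k}$ is a bijection of its set of faces that preserves containment in both directions. Consider the following automorphisms of $T_{\mathbf k}$: the group $T$ of those induced by the translations $x\mapsto x+v$ with $v\in\widetilde{\mathcal L}_d$; the automorphism $R$ induced by $x\mapsto -x$; and, for each cyclic shift $i\mapsto i+s$ of $\mathbb Z/(d+1)$ that fixes $\mathbf k$ (that is, $k_{i+s}=k_i$ for all $i$), the automorphism induced by the linear map with $\widetilde w_i\mapsto\widetilde w_{i+s}$ for all $i$. The cyclic shifts that fix $\mathbf k$ form a subgroup of the cyclic group $C_{d+1}$ of all cyclic shifts; let $\ell$ be its order. **Theorem.** The automorphism group of $T_{\mathbf k}$ is generated by $T$, $R$ and the automorphisms induced by the cyclic shifts fixing $\mathbf k$, and its order is $2\,\ell\,\det M_{\mathbf k}$. -/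

import Mathlib

open scoped Matrix

noncomputable section

namespace HeawoodTorus

/-- The hyperplane `V = {x ∈ ℝ^{d+1} : x_1 + ⋯ + x_{d+1} = 0}`; coordinates are indexed by
`Fin (d + 1)`, so that `i + 1` is the cyclic successor of the index `i`. -/
def V (d : ℕ) : Submodule ℝ (Fin (d + 1) → ℝ) where
  carrier := {x | ∑ i, x i = 0}
  zero_mem' := by simp
  add_mem' := by
    intro a b ha hb
    change ∑ i, a i = 0 at ha
    change ∑ i, b i = 0 at hb
    change ∑ i, (a i + b i) = 0
    rw [Finset.sum_add_distrib, ha, hb, add_zero]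
  smul_mem' := by
    intro c a ha
    change ∑ i, a i = 0 at ha
    change ∑ i, c * a i = 0
    rw [← Finset.mul_sum, ha, mul_zero]

/-- The smallest (closed) face containing `x` of the affine Coxeter arrangement consisting of the
hyperplanes `{y ∈ V : y_j - y_i = m}`, `m ∈ ℤ`: the set of all `y` that lie in every closed
half-space bounded by such a hyperplane that contains `x`.  The half-spaces `y_j - y_i ≥ m` are
covered by exchanging `i` and `j`. -/
def cell {d : ℕ} (x : V d) : Set (V d) :=
  {y | ∀ (i j : Fin (d + 1)) (m : ℤ), x.1 j - x.1 i ≤ m → y.1 j - y.1 i ≤ m}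

/-- The (nonempty) faces of the infinite simplicial complex into which the affine Coxeter
arrangement decomposes `V`. -/
def Face (d : ℕ) : Type :=
  {F : Set (V d) // ∃ x : V d, F = cell x}

/-- The vector `w̃_i = e_i - (1/(d+1)) ∑_j e_j` of `V`. -/
def w {d : ℕ} (i : Fin (d + 1)) : V d :=
  ⟨fun j => (if j = i then 1 else 0) - 1 / ((d : ℝ) + 1), by
    have h : (d : ℝ) + 1 ≠ 0 := by positivity
    change ∑ j : Fin (d + 1), ((if j = i then (1 : ℝ) else 0) - 1 / ((d : ℝ) + 1)) = 0
    simp [Finset.sum_sub_distrib, mul_inv_cancel₀ h]⟩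

/-- The integer linear combination `a_1 w̃_1 + ⋯ + a_{d+1} w̃_{d+1}`. -/
def comb {d : ℕ} (a : Fin (d + 1) → ℤ) : V d := ∑ i, a i • w i

lemma comb_zero {d : ℕ} : comb (0 : Fin (d + 1) → ℤ) = 0 := by simp [comb]

lemma comb_add {d : ℕ} (a b : Fin (d + 1) → ℤ) : comb (a + b) = comb a + comb b := by
  simp [comb, add_smul, Finset.sum_add_distrib]

lemma comb_neg {d : ℕ} (a : Fin (d + 1) → ℤ) : comb (-a) = -comb a := by
  simp [comb]

/-- The weight lattice: all integer linear combinations of the `w̃_i`. -/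
def weightLattice (d : ℕ) : AddSubgroup (V d) where
  carrier := {x | ∃ a : Fin (d + 1) → ℤ, x = comb a}
  zero_mem' := ⟨0, comb_zero.symm⟩
  add_mem' := by
    rintro _ _ ⟨a, rfl⟩ ⟨b, rfl⟩
    exact ⟨a + b, (comb_add a b).symm⟩
  neg_mem' := by
    rintro _ ⟨a, rfl⟩
    exact ⟨-a, (comb_neg a).symm⟩

/-- The matrix `M_k`: row `i` has the entry `k_i + 1` in column `i`, the entry `-k_{i+1}` in the
(cyclically) next column `i + 1`, and zeros elsewhere. -/
def M {d : ℕ} (k : Fin (d + 1) → ℕ) : Matrix (Fin (d + 1)) (Fin (d + 1)) ℤ :=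
  Matrix.of fun i j =>
    if j = i then (k j : ℤ) + 1 else if j = i + 1 then -(k j : ℤ) else 0

/-- The sublattice of all `a_1 w̃_1 + ⋯ + a_{d+1} w̃_{d+1}` whose coefficient vector is an integer
linear combination of the rows of `M_k`. -/
def sublattice {d : ℕ} (k : Fin (d + 1) → ℕ) : AddSubgroup (V d) where
  carrier := {x | ∃ b : Fin (d + 1) → ℤ, x = comb (b ᵥ* M k)}
  zero_mem' := ⟨0, by rw [Matrix.zero_vecMul, comb_zero]⟩
  add_mem' := by
    rintro _ _ ⟨a, rfl⟩ ⟨b, rfl⟩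
    exact ⟨a + b, by rw [Matrix.add_vecMul, comb_add]⟩
  neg_mem' := by
    rintro _ ⟨a, rfl⟩
    exact ⟨-a, by rw [Matrix.neg_vecMul, comb_neg]⟩

/-- `k`-equivalence of faces: `F' = F + v` for some `v` in the sublattice. -/
def faceSetoid {d : ℕ} (k : Fin (d + 1) → ℕ) : Setoid (Face d) where
  r F F' := ∃ v ∈ sublattice k, F'.1 = (fun x => x + v) '' F.1
  iseqv :=
    { refl := fun F => ⟨0, zero_mem _, by simp⟩
      symm := by
        rintro F F' ⟨v, hv, h⟩
        refine ⟨-v, neg_mem hv, ?_⟩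
        rw [h, Set.image_image]
        simp
      trans := by
        rintro F F' F'' ⟨v, hv, h⟩ ⟨u, hu, h'⟩
        refine ⟨v + u, add_mem hv hu, ?_⟩
        rw [h', h, Set.image_image]
        simp only [add_assoc] }

/-- The quotient complex `T_k`: the `k`-equivalence classes of faces. -/
def Torus {d : ℕ} (k : Fin (d + 1) → ℕ) : Type := Quotient (faceSetoid k)

/-- A face class is contained in another one if some representative of the first is contained in
some representative of the second. -/
instance {d : ℕ} (k : Fin (d + 1) → ℕ) : LE (Torus k) where
  le A B := ∃ F G : Face d,
    Quotient.mk (faceSetoid k) F = A ∧ Quotient.mk (faceSetoid k) G = B ∧ F.1 ⊆ G.1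

/-- The automorphism group of the simplicial complex `T_k`: the bijections of the set of its faces
which preserve incidence in both directions. -/
abbrev Aut {d : ℕ} (k : Fin (d + 1) → ℕ) : Type := Torus k ≃o Torus k

/-- The affine symmetries of the infinite complex which preserve `k`-equivalence. -/
def symmetries {d : ℕ} (k : Fin (d + 1) → ℕ) : Subgroup (V d ≃ᵃ[ℝ] V d) where
  carrier := {g | (∀ x, g '' cell x = cell (g x)) ∧
    ∀ v, g.linear v ∈ sublattice k ↔ v ∈ sublattice k}
  one_mem' := ⟨fun x => by simp, fun v => Iff.rfl⟩
  mul_mem' := by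
    rintro g h ⟨hg, hg'⟩ ⟨hh, hh'⟩
    refine ⟨fun x => ?_, fun v => ?_⟩
    · rw [AffineEquiv.mul_def, AffineEquiv.coe_trans, Set.image_comp, hh, hg, Function.comp_apply]
    · exact (hg' _).trans (hh' v)
  inv_mem' := by
    rintro g ⟨hg, hg'⟩
    refine ⟨fun x => ?_, fun v => ?_⟩
    · have h := hg (g.symm x)
      rw [AffineEquiv.apply_symm_apply] at h
      rw [AffineEquiv.inv_def, ← h, Set.image_image]
      simp
    · have h := hg' (g.linear.symm v)
      rw [LinearEquiv.apply_symm_apply] at h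
      exact h.symm

/-- The action of a symmetry of the infinite complex on its faces. -/
def mapFace {d : ℕ} {k : Fin (d + 1) → ℕ} (g : symmetries k) (F : Face d) : Face d :=
  ⟨g.1 '' F.1, by
    obtain ⟨x, hx⟩ := F.2
    exact ⟨g.1 x, by rw [hx, g.2.1]⟩⟩

lemma mapFace_mul {d : ℕ} {k : Fin (d + 1) → ℕ} (g h : symmetries k) (F : Face d) :
    mapFace (g * h) F = mapFace g (mapFace h F) :=
  Subtype.ext (Set.image_comp g.1 h.1 F.1)

lemma mapFace_one {d : ℕ} {k : Fin (d + 1) → ℕ} (F : Face d) :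
    mapFace (1 : symmetries k) F = F :=
  Subtype.ext (Set.image_id F.1)

/-- The map of face classes induced by a symmetry of the infinite complex. -/
def mapTorus {d : ℕ} {k : Fin (d + 1) → ℕ} (g : symmetries k) : Torus k → Torus k :=
  Quotient.map (mapFace g) (by
    rintro F F' ⟨v, hv, h⟩
    refine ⟨g.1.linear v, (g.2.2 v).2 hv, ?_⟩
    change g.1 '' F'.1 = (fun x => x + g.1.linear v) '' (g.1 '' F.1)
    rw [h, Set.image_image, Set.image_image]
    refine Set.image_congr fun x _ => ?_
    have := g.1.map_vadd x v
    rw [vadd_eq_add, vadd_eq_add] at this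
    rw [add_comm x v, this]
    exact add_comm _ _)

lemma mapTorus_mul {d : ℕ} {k : Fin (d + 1) → ℕ} (g h : symmetries k) (A : Torus k) :
    mapTorus (g * h) A = mapTorus g (mapTorus h A) := by
  induction A using Quotient.inductionOn with
  | h F => exact congrArg (Quotient.mk (faceSetoid k)) (mapFace_mul g h F)

lemma mapTorus_one {d : ℕ} {k : Fin (d + 1) → ℕ} (A : Torus k) :
    mapTorus (1 : symmetries k) A = A := by
  induction A using Quotient.inductionOn with
  | h F => exact congrArg (Quotient.mk (faceSetoid k)) (mapFace_one F)

lemma mapTorus_mono {d : ℕ} {k : Fin (d + 1) → ℕ} (g : symmetries k) {A B : Torus k}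
    (h : A ≤ B) : mapTorus g A ≤ mapTorus g B := by
  obtain ⟨F, G, rfl, rfl, hFG⟩ := h
  exact ⟨mapFace g F, mapFace g G, rfl, rfl, Set.image_mono hFG⟩

/-- The automorphism of `T_k` induced by a symmetry of the infinite complex which preserves
`k`-equivalence. -/
def induced {d : ℕ} (k : Fin (d + 1) → ℕ) : symmetries k →* Aut k where
  toFun g :=
    { toFun := mapTorus g
      invFun := mapTorus g⁻¹
      left_inv := fun A => by rw [← mapTorus_mul, inv_mul_cancel, mapTorus_one]
      right_inv := fun A => by rw [← mapTorus_mul, mul_inv_cancel, mapTorus_one]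
      map_rel_iff' := by
        intro A B
        refine ⟨fun h => ?_, mapTorus_mono g⟩
        have := mapTorus_mono g⁻¹ h
        simpa [← mapTorus_mul, mapTorus_one] using this }
  map_one' := by
    ext A
    exact mapTorus_one A
  map_mul' g h := by
    ext A
    exact mapTorus_mul g h A

lemma comb_apply_sub {d : ℕ} (a : Fin (d + 1) → ℤ) (i j : Fin (d + 1)) :
    (comb a).1 j - (comb a).1 i = ((a j - a i : ℤ) : ℝ) := by
  have h : ∀ l : Fin (d + 1), (comb a).1 l = a l - (∑ i, (a i : ℝ)) * (1 / ((d : ℝ) + 1)) := by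
    intro l
    simp [comb, w, mul_sub, Finset.sum_sub_distrib, Finset.sum_mul]
  rw [h, h]
  push_cast
  ring

lemma constVAdd_mem {d : ℕ} (k : Fin (d + 1) → ℕ) (v : weightLattice d) :
    AffineEquiv.constVAdd ℝ (V d) (v : V d) ∈ symmetries k := by
  obtain ⟨v, a, rfl⟩ := v
  refine ⟨fun x => ?_, fun v => Iff.rfl⟩
  have key : ∀ (i j : Fin (d + 1)) (y : V d), (comb a + y).1 j - (comb a + y).1 i =
      y.1 j - y.1 i + ((a j - a i : ℤ) : ℝ) := by
    intro i j y
    rw [← comb_apply_sub]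
    simp only [Submodule.coe_add, Pi.add_apply]
    ring
  ext y
  constructor
  · rintro ⟨z, hz, rfl⟩ i j m hm
    change (comb a + x).1 j - (comb a + x).1 i ≤ m at hm
    change (comb a + z).1 j - (comb a + z).1 i ≤ m
    rw [key] at hm ⊢
    have := hz i j (m - (a j - a i)) (by push_cast at hm ⊢; linarith)
    push_cast at this ⊢
    linarith
  · intro hy
    refine ⟨-comb a + y, fun i j m hm => ?_, by simp⟩
    have := hy i j (m + (a j - a i)) (by
      change (comb a + x).1 j - (comb a + x).1 i ≤ _
      rw [key]
      push_cast
      linarith)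
    have h2 := key i j (-comb a + y)
    rw [add_neg_cancel_left] at h2
    change (-comb a + y).1 j - (-comb a + y).1 i ≤ m
    rw [Int.cast_add] at this
    linarith

/-- The translation of `T_k` by a vector of the weight lattice. -/
def translation {d : ℕ} (k : Fin (d + 1) → ℕ) (v : weightLattice d) : Aut k :=
  induced k ⟨AffineEquiv.constVAdd ℝ (V d) (v : V d), constVAdd_mem k v⟩

lemma neg_mem_symmetries {d : ℕ} (k : Fin (d + 1) → ℕ) :
    (LinearEquiv.neg ℝ (M := V d)).toAffineEquiv ∈ symmetries k := by
  have key : ∀ x y : V d, y ∈ cell x → -y ∈ cell (-x) := by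
    intro x y h i j m hm
    have := h j i m (by simp at hm; linarith)
    simp
    linarith
  refine ⟨fun x => ?_, fun v => ?_⟩
  · ext y
    constructor
    · rintro ⟨z, hz, rfl⟩
      exact key x z hz
    · intro hy
      refine ⟨-y, ?_, neg_neg y⟩
      have := key _ _ hy
      change -y ∈ cell (- -x) at this
      rwa [neg_neg] at this
  · exact neg_mem_iff

/-- The automorphism `R` of `T_k` induced by `x ↦ -x`, that is, by `w̃_i ↦ -w̃_i`. -/
def R {d : ℕ} (k : Fin (d + 1) → ℕ) : Aut k :=
  induced k ⟨(LinearEquiv.neg ℝ (M := V d)).toAffineEquiv, neg_mem_symmetries k⟩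

/-- The permutation of coordinates of `V` with `e_i ↦ e_{σ i}`, hence `w̃_i ↦ w̃_{σ i}`. -/
def permV {d : ℕ} (σ : Equiv.Perm (Fin (d + 1))) : V d ≃ₗ[ℝ] V d where
  toFun x := ⟨fun i => x.1 (σ.symm i), (Equiv.sum_comp σ.symm x.1).trans x.2⟩
  invFun x := ⟨fun i => x.1 (σ i), (Equiv.sum_comp σ x.1).trans x.2⟩
  left_inv x := by simp
  right_inv x := by simp
  map_add' x y := rfl
  map_smul' c x := rfl

/-- The group of those cyclic shifts `i ↦ i + s` of the positions which fix the sequence `k`,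
a subgroup of the cyclic group `C_{d+1}` of all cyclic shifts. -/
def shiftStabilizer {d : ℕ} (k : Fin (d + 1) → ℕ) : Subgroup (Equiv.Perm (Fin (d + 1))) where
  carrier := {σ | σ ∈ Subgroup.zpowers (finRotate (d + 1)) ∧ ∀ i, k (σ i) = k i}
  one_mem' := ⟨one_mem _, fun _ => rfl⟩
  mul_mem' := by
    rintro σ τ ⟨h, h'⟩ ⟨g, g'⟩
    exact ⟨mul_mem h g, fun i => (h' _).trans (g' i)⟩
  inv_mem' := by
    rintro σ ⟨h, h'⟩
    refine ⟨inv_mem h, fun i => ?_⟩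
    have := h' (σ⁻¹ i)
    have h2 : σ (σ⁻¹ i) = i := σ.apply_symm_apply i
    rw [h2] at this
    exact this.symm

lemma shift_succ {d : ℕ} {σ : Equiv.Perm (Fin (d + 1))}
    (h : σ ∈ Subgroup.zpowers (finRotate (d + 1))) (i : Fin (d + 1)) : σ (i + 1) = σ i + 1 := by
  obtain ⟨n, rfl⟩ := h
  have := DFunLike.congr_fun ((Commute.refl (finRotate (d + 1))).zpow_left n) i
  simpa using this

lemma M_shift {d : ℕ} {k : Fin (d + 1) → ℕ} {σ : Equiv.Perm (Fin (d + 1))}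
    (h : σ ∈ shiftStabilizer k) (i j : Fin (d + 1)) : M k (σ i) (σ j) = M k i j := by
  simp only [M, Matrix.of_apply, ← shift_succ h.1, h.2, σ.injective.eq_iff]

lemma permV_comb {d : ℕ} (σ : Equiv.Perm (Fin (d + 1))) (a : Fin (d + 1) → ℤ) :
    permV σ (comb a) = comb (fun i => a (σ.symm i)) := by
  have hw : ∀ i, permV σ (w i) = w (σ i) := by
    intro i
    ext j
    simp [permV, w, Equiv.symm_apply_eq]
  unfold comb
  rw [map_sum, ← Equiv.sum_comp σ (fun i => a (σ.symm i) • w i)]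
  simp [map_zsmul, hw]

lemma permV_mem_sublattice {d : ℕ} {k : Fin (d + 1) → ℕ} {σ : Equiv.Perm (Fin (d + 1))}
    (h : σ ∈ shiftStabilizer k) {v : V d} (hv : v ∈ sublattice k) :
    permV σ v ∈ sublattice k := by
  obtain ⟨b, rfl⟩ := hv
  refine ⟨fun i => b (σ.symm i), ?_⟩
  rw [permV_comb]
  congr 1
  ext j
  change ∑ i, b i * M k i (σ.symm j) = ∑ i, b (σ.symm i) * M k i j
  rw [← Equiv.sum_comp σ (fun i => b (σ.symm i) * M k i j)]
  refine Finset.sum_congr rfl fun i _ => ?_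
  have := M_shift h i (σ.symm j)
  rw [Equiv.apply_symm_apply] at this
  rw [this, Equiv.symm_apply_apply]

lemma permV_mem_symmetries {d : ℕ} {k : Fin (d + 1) → ℕ} (σ : shiftStabilizer k) :
    (permV σ.1).toAffineEquiv ∈ symmetries k := by
  obtain ⟨σ, hσ⟩ := σ
  refine ⟨fun x => ?_, fun v => ⟨fun h => ?_, permV_mem_sublattice hσ⟩⟩
  · ext y
    constructor
    · rintro ⟨z, hz, rfl⟩ i j m hm
      exact hz (σ.symm i) (σ.symm j) m hm
    · intro hy
      refine ⟨(permV σ).symm y, fun i j m hm => ?_, (permV σ).apply_symm_apply y⟩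
      refine hy (σ i) (σ j) m ?_
      simpa [permV] using hm
  · have := permV_mem_sublattice (inv_mem hσ) h
    have h2 : permV σ⁻¹ (permV σ v) = v := (permV σ).symm_apply_apply v
    exact h2 ▸ this

/-- The automorphism of `T_k` induced by a cyclic shift of the `w̃_i` which fixes `k`. -/
def shift {d : ℕ} (k : Fin (d + 1) → ℕ) (σ : shiftStabilizer k) : Aut k :=
  induced k ⟨(permV σ.1).toAffineEquiv, permV_mem_symmetries σ⟩

end HeawoodTorus

end

noncomputable section

namespace HeawoodTorus

/-! Two integer vectors give the same vertex `comb a` exactly when they differ by a constant vector,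
and constants lie in the row lattice of `M k`; so the vertices of the torus are ℤ^(d+1) modulo that
lattice. A nonconstant vector of the row lattice has two entries at least 3 apart
(`eq_of_mem_rowLattice`), whereas vertices of faces through a common vertex differ by vectors of
spread at most 2. Hence nothing collapses near a vertex: a face class is determined by its vertices,
and the neighbours of a vertex are the proper nonempty index sets, two of them lying in a common
face with that vertex exactly when the sets are comparable.

A bijection of subsets respecting comparability comes from a permutation of the indices, possibly
followed by complementation (`exists_perm_of_comparable_iff`); modulo constants, complementation is
the sign change `x ↦ -x`. So an automorphism acts around each vertex as a signed permutation, and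
overlapping neighbourhoods force the same one everywhere (`exists_apply_vert_eq`): on vertices it is
`a ↦ c + ε • (a permuted by σ)`.

Being well defined on classes, it makes `σ` preserve the row lattice. An extremal estimate on
lattice vectors with two nonzero entries, summed over all rows, then forces `σ` to be a cyclic shift
fixing `k` (`mem_shiftStabilizer`). Thus translations, `R` and shifts generate, and the order counts
the independent choices of `c` modulo the row lattice (`det (M k)` classes), `ε` and `σ`. -/

open Fin.CommRing in
lemma cyclic_induction {d : ℕ} {P : Fin (d + 1) → Prop} {i : Fin (d + 1)} (hi : P i)
    (h : ∀ j, P j → P (j + 1)) (j : Fin (d + 1)) : P j := by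
  have key : ∀ n : ℕ, P (i + (n : Fin (d + 1))) := by
    intro n
    induction n with
    | zero => simpa using hi
    | succ n ih => rw [Nat.cast_succ, ← add_assoc]; exact h _ ih
  have := key (j - i).val
  rwa [Fin.cast_val_eq_self, add_sub_cancel] at this

lemma cyclic_induction_pred {d : ℕ} {P : Fin (d + 1) → Prop} {i : Fin (d + 1)} (hi : P i)
    (h : ∀ j, P j → P (j - 1)) (j : Fin (d + 1)) : P j := by
  have := cyclic_induction (P := fun l => P (-l)) (i := -i) (by simpa using hi)
    (fun l hl => by rw [neg_add, ← sub_eq_add_neg]; exact h _ hl) (-j)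
  simpa using this

lemma add_one_ne_self {d : ℕ} (hd : 1 ≤ d) (i : Fin (d + 1)) : i + 1 ≠ i := by
  obtain ⟨e, rfl⟩ : ∃ e, d = e + 1 := ⟨d - 1, by omega⟩
  intro h
  have : (1 : Fin (e + 1 + 1)) = 0 := add_eq_left.1 h
  simp at this

lemma add_two_ne_self {d : ℕ} (hd : 2 ≤ d) (i : Fin (d + 1)) : i + 1 + 1 ≠ i := by
  obtain ⟨e, rfl⟩ : ∃ e, d = e + 2 := ⟨d - 2, by omega⟩
  intro h
  have h1 : (1 : Fin (e + 2 + 1)) + 1 = 0 := add_eq_left.1 ((add_assoc i 1 1).symm.trans h)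
  simp only [Fin.ext_iff, Fin.val_add, Fin.val_one, Fin.val_zero] at h1
  rw [Nat.mod_eq_of_lt (by omega)] at h1
  omega

/-! ### The row lattice and its short vectors -/

/-- The lattice of integer linear combinations of the rows of `M k`. -/
def rowLattice {d : ℕ} (k : Fin (d + 1) → ℕ) : Submodule ℤ (Fin (d + 1) → ℤ) :=
  LinearMap.range (M k).vecMulLinear

lemma mem_rowLattice {d : ℕ} {k : Fin (d + 1) → ℕ} {a : Fin (d + 1) → ℤ} :
    a ∈ rowLattice k ↔ ∃ b : Fin (d + 1) → ℤ, b ᵥ* M k = a := Iff.rfl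

/-- Column `j` meets only rows `j` and `j - 1`, which are distinct because `d ≥ 1`. Writing the
entry through the jump `b j - b (j - 1)` allows maximum-principle arguments on `b`. -/
lemma vecMul_M_apply {d : ℕ} (hd : 1 ≤ d) (k : Fin (d + 1) → ℕ) (b : Fin (d + 1) → ℤ)
    (j : Fin (d + 1)) : (b ᵥ* M k) j = b j + k j * (b j - b (j - 1)) := by
  have h : ∀ i, b i * M k i j = (if i = j then b i * (k j + 1) else 0) +
      (if i = j - 1 then b i * (-k j) else 0) := by
    intro i
    have hj : j ≠ j - 1 := fun h => add_one_ne_self hd j (by rw [eq_sub_iff_add_eq] at h; exact h)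
    by_cases h1 : i = j
    · subst h1; simp [M, hj]
    · by_cases h2 : i = j - 1
      · subst h2; simp [M, hj, hj.symm]
      · have h3 : ¬ j = i + 1 := fun h => h2 (by rw [h]; simp)
        simp [M, h1, h2, h3, Ne.symm h1]
  change ∑ i, b i * M k i j = _
  simp_rw [h]
  rw [Finset.sum_add_distrib]
  simp only [Finset.sum_ite_eq', Finset.mem_univ, if_true]
  ring

lemma const_mem_rowLattice {d : ℕ} (hd : 1 ≤ d) (k : Fin (d + 1) → ℕ) {a : Fin (d + 1) → ℤ}
    (h : ∀ i j, a i = a j) : a ∈ rowLattice k :=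
  ⟨a, by ext j; rw [Matrix.vecMulLinear_apply, vecMul_M_apply hd, h j (j - 1)]; simp⟩

/-- The only vectors of the row lattice whose entries are pairwise at distance at most `2` are
the constant ones. -/
lemma eq_of_mem_rowLattice {d : ℕ} (hd : 1 ≤ d) {k : Fin (d + 1) → ℕ} (hk : ∀ i, 1 ≤ k i)
    {a : Fin (d + 1) → ℤ} (ha : a ∈ rowLattice k) (h : ∀ i j, a j - a i ≤ 2) (i j : Fin (d + 1)) :
    a i = a j := by
  obtain ⟨b, rfl⟩ := mem_rowLattice.1 ha
  have hk' : ∀ i, (1 : ℤ) ≤ k i := fun i => by exact_mod_cast hk i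
  obtain ⟨p, hp⟩ := Finite.exists_max b
  obtain ⟨q, hq⟩ := Finite.exists_min b
  by_cases hc : ∀ l, b l = b p
  · rw [vecMul_M_apply hd, vecMul_M_apply hd, hc i, hc j, hc (i - 1), hc (j - 1)]; simp
  · exfalso
    obtain ⟨l, hl⟩ := not_forall.1 hc
    -- A place where `b` jumps up to its maximum; `q'` below is where it drops to its minimum. The
    -- entries there are at least `b p + 1` and at most `b q - 1`, so they differ by at least 3.
    obtain ⟨p', hp', hp2⟩ : ∃ p', b p' = b p ∧ b (p' - 1) ≠ b p := by
      by_contra! hcon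
      exact hl (cyclic_induction_pred (P := fun j => b j = b p) rfl hcon l)
    have hlq : b p ≠ b q := fun h => hl (le_antisymm (hp l) (h ▸ hq l))
    obtain ⟨q', hq', hq2⟩ : ∃ q', b q' = b q ∧ b (q' - 1) ≠ b q := by
      by_contra! hcon
      exact hlq (cyclic_induction_pred (P := fun j => b j = b q) rfl hcon p)
    have h1 := h q' p'
    rw [vecMul_M_apply hd, vecMul_M_apply hd, hp', hq'] at h1
    have h2 : b (p' - 1) < b p := lt_of_le_of_ne (hp _) hp2
    have h3 : b q < b (q' - 1) := lt_of_le_of_ne (hq _) hq2.symm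
    have h4 : b q < b p := lt_of_le_of_ne (hq p) hlq.symm
    nlinarith [mul_le_mul_of_nonneg_right (hk' p') (sub_nonneg.2 h2.le),
      mul_le_mul_of_nonneg_right (hk' q') (sub_nonneg.2 h3.le)]

/-! ### Permutations preserving the row lattice -/

/-- Away from `p` and `q`, `b j` is `b (j - 1)` scaled by `k j / (1 + k j)`, so `b` keeps its sign
and shrinks. Its maximum therefore sits only at `p`, and `b` drops at `q`; the sizes of the two
jumps bound `x + y` from below. In the equality case `b` is 1 at `p` and 0 at `p - 1` and `q = p +
1`, as for the row `p` itself. -/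
lemma two_term_row {d : ℕ} (hd : 2 ≤ d) {k b : Fin (d + 1) → ℤ} (hk : ∀ i, 1 ≤ k i)
    {p q : Fin (d + 1)} {x y : ℤ} (hx : 0 ≤ x) (hy : 0 < y)
    (hp : b p + k p * (b p - b (p - 1)) = x + 1)
    (hq : b q + k q * (b q - b (q - 1)) = -y)
    (h0 : ∀ j, j ≠ p → j ≠ q → b j + k j * (b j - b (j - 1)) = 0) (hpos : ∃ j, 0 < b j) :
    k p + k q ≤ x + y ∧ (k p + k q = x + y → x = k p ∧ y = k q ∧ q = p + 1) := by
  have hpq : p ≠ q := by rintro rfl; linarith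
  have step_pos : ∀ j, j ≠ p → j ≠ q → 0 < b (j - 1) → 0 < b j := by
    intro j h1 h2 h3
    by_contra! h4
    nlinarith [h0 j h1 h2, mul_pos (by linarith [hk j] : 0 < k j) h3,
      mul_nonneg (by linarith [hk j] : 0 ≤ k j) (neg_nonneg.2 h4)]
  have step_neg : ∀ j, j ≠ p → j ≠ q → b (j - 1) < 0 → b j < 0 := by
    intro j h1 h2 h3
    by_contra! h4
    nlinarith [h0 j h1 h2, mul_pos (by linarith [hk j] : 0 < k j) (neg_pos.2 h3),
      mul_nonneg (by linarith [hk j] : 0 ≤ k j) h4]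
  have step_zero : ∀ j, j ≠ p → j ≠ q → b (j - 1) = 0 → b j = 0 := by
    intro j h1 h2 h3
    have := h0 j h1 h2
    rw [h3] at this
    have h4 : b j * (1 + k j) = 0 := by linarith
    rcases mul_eq_zero.1 h4 with h | h
    · exact h
    · linarith [hk j]
  have step_lt : ∀ j, j ≠ p → 0 < b j → b j < b (j - 1) := by
    intro j h1 h3
    by_contra! h4
    have h5 := mul_nonneg (by linarith [hk j] : 0 ≤ k j) (sub_nonneg.2 h4)
    by_cases h2 : j = q
    · subst h2; linarith
    · linarith [h0 j h1 h2]
  obtain ⟨p0, hp0⟩ := Finite.exists_max b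
  obtain ⟨j0, hj0⟩ := hpos
  have hmax : ∀ j, (∀ l, b l ≤ b j) → j = p := by
    intro j hj
    by_contra h
    linarith [step_lt j h (lt_of_lt_of_le hj0 (hj _)), hj (j - 1)]
  obtain rfl : p0 = p := hmax p0 hp0
  have hbp : 0 < b p0 := hj0.trans_le (hp0 _)
  have huniq : ∀ j, b j = b p0 → j = p0 := fun j hj => hmax j (fun l => hj ▸ hp0 l)
  set p := p0
  have hq1 : 0 < b (q - 1) := by
    by_contra hcon
    refine hcon (cyclic_induction (P := fun j => 0 < b j) hbp (fun j hj => ?_) (q - 1))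
    by_cases h1 : j + 1 = p
    · rwa [h1]
    by_cases h2 : j + 1 = q
    · exact absurd (by rw [← h2]; simpa using hj) hcon
    · exact step_pos _ h1 h2 (by simpa using hj)
  have hlt : b q < b (q - 1) := by
    by_contra! h4
    have h5 := mul_nonneg (by linarith [hk q] : 0 ≤ k q) (sub_nonneg.2 h4)
    linarith
  have hkp := hk p
  have hkq := hk q
  -- If `b q < 0`, then `b` is still negative at `p - 1`, so both jumps are at least 2 and the
  -- inequality is strict. Otherwise both are at least 1, and equality makes both exactly 1.
  rcases lt_or_ge (b q) 0 with hneg | hnn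
  · have hp1 : b (p - 1) < 0 := by
      by_contra hcon
      refine hcon (cyclic_induction (P := fun j => b j < 0) hneg (fun j hj => ?_) (p - 1))
      by_cases h2 : j + 1 = q
      · rwa [h2]
      by_cases h1 : j + 1 = p
      · exact absurd (by rw [← h1]; simpa using hj) hcon
      · exact step_neg _ h1 h2 (by simpa using hj)
    have e1 := mul_le_mul_of_nonneg_left (by linarith : 2 ≤ b p - b (p - 1)) (by linarith : 0 ≤ k p)
    have e2 := mul_le_mul_of_nonneg_left (by linarith : 2 ≤ b (q - 1) - b q) (by linarith : 0 ≤ k q)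
    constructor
    · linarith
    · intro; linarith
  · have hcmp : b (p - 1) ≤ b q ∧ (b (p - 1) = b q → b q = 0 ∨ p - 1 = q) := by
      rcases hnn.eq_or_lt with hz | hz
      · have hp1 : b (p - 1) = 0 := by
          by_contra hcon
          refine hcon (cyclic_induction (P := fun j => b j = 0) hz.symm (fun j hj => ?_) (p - 1))
          by_cases h2 : j + 1 = q
          · rw [h2, hz]
          by_cases h1 : j + 1 = p
          · exact absurd (by rw [← h1]; simpa using hj) hcon
          · exact step_zero _ h1 h2 (by simpa using hj)
        exact ⟨by linarith, fun _ => Or.inl hz.symm⟩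
      · have hall : ∀ j, 0 < b j := cyclic_induction (P := fun j => 0 < b j) hbp (fun j hj => by
          by_cases h1 : j + 1 = p
          · rwa [h1]
          by_cases h2 : j + 1 = q
          · rwa [h2]
          · exact step_pos _ h1 h2 (by simpa using hj))
        have hmin : ∀ j, (∀ l, b j ≤ b l) → j = p - 1 := by
          intro j hj
          by_contra h
          have h1 : j + 1 ≠ p := fun h' => h (by rw [← h']; simp)
          have h2 := step_lt (j + 1) h1 (hall _)
          rw [add_sub_cancel_right] at h2
          linarith [hj (j + 1)]
        obtain ⟨m, hm⟩ := Finite.exists_min b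
        obtain rfl := hmin m hm
        exact ⟨hm q, fun h => Or.inr (hmin q (fun l => h ▸ hm l)).symm⟩
    obtain ⟨hc1, hc2⟩ := hcmp
    have hm1 := hp0 (q - 1)
    have e1 := mul_nonneg (by linarith : 0 ≤ k p - 1) (by linarith : 0 ≤ b p - b (p - 1) - 1)
    have e2 := mul_nonneg (by linarith : 0 ≤ k q - 1) (by linarith : 0 ≤ b (q - 1) - b q - 1)
    constructor
    · linarith
    · intro heq
      have a1 : b (q - 1) = b p := by linarith
      have a2 : b (q - 1) = b q + 1 := by linarith
      have a3 : b (p - 1) = b q := by linarith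
      have a4 : q = p + 1 := by rw [← huniq _ a1]; simp
      rcases hc2 a3 with hz | hz
      · rw [← a1, a2, a3, hz] at hp
        rw [a2, hz] at hq
        exact ⟨by linarith, by linarith, a4⟩
      · exact absurd (by rw [← a4, ← hz]; simp) (add_two_ne_self hd p)

open Fin.CommRing in
lemma mem_zpowers_finRotate {d : ℕ} {σ : Equiv.Perm (Fin (d + 1))}
    (h : ∀ i, σ (i + 1) = σ i + 1) : σ ∈ Subgroup.zpowers (finRotate (d + 1)) := by
  have hpow : ∀ (n : ℕ) i, (finRotate (d + 1) ^ n) i = i + (n : Fin (d + 1)) := by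
    intro n
    induction n with
    | zero => simp
    | succ n ih => intro i; rw [pow_succ']; simp [ih, add_assoc]
  refine ⟨((σ 0).val : ℤ), ?_⟩
  ext1 i
  simp only [zpow_natCast]
  rw [hpow, Fin.cast_val_eq_self]
  refine cyclic_induction (P := fun i => i + σ 0 = σ i) (i := 0) (zero_add _) (fun j hj => ?_) i
  rw [h, ← hj]
  abel

/-- A permutation of the coordinates preserving the row lattice is a cyclic shift fixing `k`. -/
lemma mem_shiftStabilizer {d : ℕ} (hd : 2 ≤ d) {k : Fin (d + 1) → ℕ} (hk : ∀ i, 1 ≤ k i)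
    {σ : Equiv.Perm (Fin (d + 1))}
    (hσ : ∀ v ∈ rowLattice k, (fun i => v (σ.symm i)) ∈ rowLattice k) :
    σ ∈ shiftStabilizer k := by
  have hk' : ∀ i, (1 : ℤ) ≤ k i := fun i => by exact_mod_cast hk i
  have key : ∀ i, ((k (σ i) : ℤ) + k (σ (i + 1)) ≤ k i + k (i + 1)) ∧
      ((k (σ i) : ℤ) + k (σ (i + 1)) = k i + k (i + 1) →
        ((k i : ℤ) = k (σ i) ∧ σ (i + 1) = σ i + 1) ∨ (k (i + 1) : ℤ) = k (σ (i + 1)) + 1 ∧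
          (k (σ i) : ℤ) = k i + 1) := by
    intro i
    have hmem : M k i ∈ rowLattice k :=
      ⟨Pi.single i 1, by rw [Matrix.vecMulLinear_apply, Matrix.single_one_vecMul]; rfl⟩
    obtain ⟨b, hb⟩ := mem_rowLattice.1 (hσ _ hmem)
    have hb' : ∀ j, b j + k j * (b j - b (j - 1)) = M k i (σ.symm j) := fun j => by
      rw [← vecMul_M_apply (by omega), hb]
    have hi1 := add_one_ne_self (by omega : 1 ≤ d) i
    have hp := hb' (σ i)
    have hq := hb' (σ (i + 1))
    have h0 : ∀ j, j ≠ σ i → j ≠ σ (i + 1) → b j + k j * (b j - b (j - 1)) = 0 := by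
      intro j h1 h2
      rw [hb']
      simp [M, Equiv.symm_apply_eq, h1, h2]
    simp only [Equiv.symm_apply_apply, M, Matrix.of_apply, if_true, if_neg hi1] at hp hq
    -- If `b` is nowhere positive, the estimate applies to `-b` with `p` and `q` exchanged. The two
    -- prescribed entries then shift by one in opposite directions, leaving `x + y` unchanged.
    by_cases hpos : ∃ j, 0 < b j
    · have := two_term_row hd (k := fun i => (k i : ℤ)) hk' (x := k i) (y := k (i + 1))
        (by linarith [hk' i]) (by linarith [hk' (i + 1)]) hp hq h0 hpos
      exact ⟨this.1, fun h => Or.inl ⟨(this.2 h).1, (this.2 h).2.2⟩⟩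
    · push Not at hpos
      have hpos' : ∃ j, 0 < (-b) j := by
        by_contra! hcon
        have hz : ∀ j, b j = 0 := fun j => le_antisymm (hpos j) (by simpa using hcon j)
        rw [hz, hz] at hp
        simp at hp
        linarith [hk' i]
      have := two_term_row hd (k := fun i => (k i : ℤ)) (b := -b) (p := σ (i + 1)) (q := σ i) hk'
        (x := k (i + 1) - 1) (y := k i + 1)
        (by linarith [hk' (i + 1)]) (by linarith [hk' i])
        (by simp only [Pi.neg_apply]; linarith) (by simp only [Pi.neg_apply]; linarith)
        (fun j h1 h2 => by have := h0 j h2 h1; simp only [Pi.neg_apply]; linarith) hpos'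
      refine ⟨by linarith [this.1], fun h => Or.inr ?_⟩
      have := this.2 (by linarith)
      constructor <;> linarith [this.1, this.2.1]
  -- Both sums are twice the sum of `k`, so every inequality in `key` is an equality.
  have hsum1 : ∑ i, ((k (σ i) : ℤ) + k (σ (i + 1))) = ∑ i, ((k i : ℤ) + k (i + 1)) := by
    rw [Finset.sum_add_distrib, Finset.sum_add_distrib]
    have e1 := Equiv.sum_comp σ (fun i => (k i : ℤ))
    have e2 := Equiv.sum_comp (Equiv.addRight (1 : Fin (d + 1))) (fun i => (k (σ i) : ℤ))
    have e3 := Equiv.sum_comp (Equiv.addRight (1 : Fin (d + 1))) (fun i => (k i : ℤ))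
    simp only [Equiv.coe_addRight] at e2 e3
    rw [e2, e3, e1]
  have heq := (Finset.sum_eq_sum_iff_of_le (fun i _ => (key i).1)).1 hsum1
  have hres : ∀ i, (k i : ℤ) = k (σ i) ∧ σ (i + 1) = σ i + 1 := by
    intro i
    rcases (key i).2 (heq i (Finset.mem_univ i)) with h | h
    · exact h
    -- The second alternative at `i` makes `k (i + 1)` exceed `k (σ (i + 1))` by one, contradicting
    -- either alternative at `i + 1`.
    · rcases (key (i + 1)).2 (heq (i + 1) (Finset.mem_univ _)) with h' | h'
      · linarith [h.1, h'.1]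
      · linarith [h.1, h'.2]
  exact ⟨mem_zpowers_finRotate fun i => (hres i).2, fun i => by exact_mod_cast (hres i).1.symm⟩

/-! ### The determinant and the index of the row lattice -/

/-- Replacing `k` by `t * k` joins the identity to `M k` through matrices that are strictly
diagonally dominant by columns, so the determinant never vanishes along the way. -/
lemma det_M_pos {d : ℕ} (k : Fin (d + 1) → ℕ) : 0 < (M k).det := by
  let A : ℝ → Matrix (Fin (d + 1)) (Fin (d + 1)) ℝ := fun t => Matrix.of fun i j =>
    if j = i then t * k j + 1 else if j = i + 1 then -(t * k j) else 0
  have hcont : Continuous fun t => (A t).det := by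
    refine Continuous.matrix_det (continuous_matrix fun i j => ?_)
    simp only [A, Matrix.of_apply]
    split_ifs <;> fun_prop
  have hne : ∀ t ∈ Set.Icc (0 : ℝ) 1, (A t).det ≠ 0 := by
    intro t ht
    refine det_ne_zero_of_sum_col_lt_diag fun j => ?_
    have hk : 0 ≤ t * k j := mul_nonneg ht.1 (Nat.cast_nonneg _)
    have h1 : ∀ i ∈ Finset.univ.erase j, ‖A t i j‖ = if i = j - 1 then t * k j else 0 := by
      intro i hi
      have hij : ¬ j = i := (Finset.ne_of_mem_erase hi).symm
      simp only [A, Matrix.of_apply, if_neg hij]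
      by_cases h : j = i + 1
      · rw [if_pos h, if_pos (by rw [h, add_sub_cancel_right]), norm_neg, Real.norm_of_nonneg hk]
      · rw [if_neg h, if_neg (fun h' => h (by rw [h', sub_add_cancel])), norm_zero]
    rw [Finset.sum_congr rfl h1, Finset.sum_ite_eq']
    simp only [A, Matrix.of_apply, if_true]
    rw [Real.norm_of_nonneg (by linarith)]
    split_ifs <;> linarith
  have h0 : (A 0).det = 1 := by
    have : A 0 = 1 := by
      ext i j
      simp [A, Matrix.one_apply, eq_comm]
    rw [this, Matrix.det_one]
  have hpos : 0 < (A 1).det := by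
    by_contra! h
    obtain ⟨t, ht, ht0⟩ := intermediate_value_Icc' zero_le_one hcont.continuousOn
      (show (0 : ℝ) ∈ Set.Icc (A 1).det (A 0).det from ⟨h, by rw [h0]; exact zero_le_one⟩)
    exact hne t ht ht0
  have hM : A 1 = (M k).map (Int.castRingHom ℝ) := by
    ext i j
    simp only [A, M, Matrix.of_apply, Matrix.map_apply]
    split_ifs <;> simp
  rw [hM, ← RingHom.mapMatrix_apply, ← RingHom.map_det] at hpos
  exact Int.cast_pos.1 hpos

lemma card_quotient_rowLattice {d : ℕ} (k : Fin (d + 1) → ℕ) :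
    (Nat.card ((Fin (d + 1) → ℤ) ⧸ rowLattice k) : ℤ) = (M k).det := by
  have hdet := det_M_pos k
  have hinj : Function.Injective (M k).vecMulLinear :=
    (injective_iff_map_eq_zero _).2 fun v hv =>
      Matrix.eq_zero_of_vecMul_eq_zero hdet.ne' hv
  let e : (Fin (d + 1) → ℤ) ≃ₗ[ℤ] rowLattice k := LinearEquiv.ofInjective (M k).vecMulLinear hinj
  have h := Submodule.natAbs_det_equiv (rowLattice k) e
  have h2 : (rowLattice k).subtype ∘ₗ AddMonoidHom.toIntLinearMap
      (e : (Fin (d + 1) → ℤ) →+ rowLattice k) = (M k).vecMulLinear := by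
    ext; rfl
  rw [h2, ← Matrix.mulVecLin_transpose, ← Matrix.toLin'_apply', LinearMap.det_toLin',
    Matrix.det_transpose] at h
  rw [← h]
  exact Int.natAbs_of_nonneg hdet.le

/-! ### Faces -/

lemma mem_cell_self {d : ℕ} (x : V d) : x ∈ cell x := fun _ _ _ h => h

lemma cell_subset {d : ℕ} {x y : V d} (h : y ∈ cell x) : cell y ⊆ cell x :=
  fun _ hz i j m hm => hz i j m (h i j m hm)

lemma comb_mem_cell {d : ℕ} {x : V d} {a : Fin (d + 1) → ℤ} :
    comb a ∈ cell x ↔ ∀ (i j : Fin (d + 1)) (m : ℤ), x.1 j - x.1 i ≤ m → a j - a i ≤ m := by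
  simp only [cell, Set.mem_ofPred_eq, comb_apply_sub, Int.cast_le]

lemma eq_of_forall_sub {d : ℕ} {x y : V d} (h : ∀ i j, x.1 j - x.1 i ≤ y.1 j - y.1 i) : x = y := by
  have hx : ∑ i, x.1 i = 0 := x.2
  have hy : ∑ i, y.1 i = 0 := y.2
  have h' : ∀ i j, x.1 j - y.1 j = x.1 i - y.1 i := fun i j => by
    linarith [h i j, h j i]
  ext j
  have h2 : ∑ i : Fin (d + 1), (x.1 i - y.1 i) = ∑ i : Fin (d + 1), (x.1 j - y.1 j) :=
    Finset.sum_congr rfl fun i _ => h' j i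
  rw [Finset.sum_sub_distrib, hx, hy, Finset.sum_const, Finset.card_univ, Fintype.card_fin] at h2
  have h3 : ((d : ℝ) + 1) * (x.1 j - y.1 j) = 0 := by
    rw [nsmul_eq_mul] at h2; push_cast at h2; linarith
  rcases mul_eq_zero.1 h3 with h4 | h4
  · exact absurd h4 (by positivity)
  · linarith

lemma comb_eq_comb {d : ℕ} {a b : Fin (d + 1) → ℤ} :
    comb a = comb b ↔ ∀ i j, (a - b) i = (a - b) j := by
  constructor
  · intro h i j
    have h1 := comb_apply_sub a i j
    rw [h, comb_apply_sub] at h1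
    have h2 : b j - b i = a j - a i := by exact_mod_cast h1
    simp only [Pi.sub_apply]
    linarith
  · intro h
    refine eq_of_forall_sub fun i j => ?_
    rw [comb_apply_sub, comb_apply_sub]
    have := h i j
    simp only [Pi.sub_apply] at this
    exact_mod_cast (by linarith : a j - a i ≤ b j - b i)

lemma cell_comb {d : ℕ} (a : Fin (d + 1) → ℤ) : cell (comb a) = {comb a} := by
  ext y
  refine ⟨fun h => eq_of_forall_sub fun i j => ?_, fun h => h ▸ mem_cell_self _⟩
  rw [comb_apply_sub]
  exact h i j _ (comb_apply_sub a i j).le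

/-- Every upper bound defining a face is attained at a lattice point of the face. -/
lemma exists_comb_mem_cell {d : ℕ} (x : V d) (i j : Fin (d + 1)) :
    ∃ a : Fin (d + 1) → ℤ, comb a ∈ cell x ∧ x.1 j - x.1 i ≤ ((a j - a i : ℤ) : ℝ) := by
  -- Round up exactly the coordinates whose fractional part reaches that of `x j`. Rounding at a
  -- common threshold keeps every integral upper bound on differences.
  refine ⟨fun l => ⌊x.1 l⌋ + if Int.fract (x.1 j) ≤ Int.fract (x.1 l) then 1 else 0,
    comb_mem_cell.2 fun p q m hm => ?_, ?_⟩
  · have h1 := Int.fract_nonneg (x.1 q)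
    have h2 := Int.fract_lt_one (x.1 p)
    have h3 := Int.floor_add_fract (x.1 q)
    have h4 := Int.floor_add_fract (x.1 p)
    have h5 : ⌊x.1 q⌋ - ⌊x.1 p⌋ < m + 1 := by
      have : ((⌊x.1 q⌋ - ⌊x.1 p⌋ : ℤ) : ℝ) < ((m + 1 : ℤ) : ℝ) := by push_cast; linarith
      exact_mod_cast this
    have h6 : Int.fract (x.1 p) < Int.fract (x.1 q) → ⌊x.1 q⌋ - ⌊x.1 p⌋ < m := by
      intro h
      have : ((⌊x.1 q⌋ - ⌊x.1 p⌋ : ℤ) : ℝ) < (m : ℝ) := by push_cast; linarith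
      exact_mod_cast this
    split_ifs with ha hb hb
    · linarith
    · linarith [h6 (by linarith)]
    · linarith
    · linarith
  · have h1 := Int.fract_nonneg (x.1 i)
    have h2 := Int.fract_lt_one (x.1 j)
    have h3 := Int.floor_add_fract (x.1 j)
    have h4 := Int.floor_add_fract (x.1 i)
    simp only [le_refl, if_true]
    push_cast
    split_ifs with h <;> linarith

lemma cell_subset_of_comb {d : ℕ} {x y : V d} (h : ∀ a, comb a ∈ cell x → comb a ∈ cell y) :
    cell x ⊆ cell y := by
  refine cell_subset fun i j m hm => ?_
  obtain ⟨a, ha, ha'⟩ := exists_comb_mem_cell x i j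
  exact ha'.trans (by exact_mod_cast comb_mem_cell.1 (h a ha) i j m hm)

/-- Lattice points of a common face differ by a vector whose entries are pairwise at distance at
most `1`. -/
lemma sub_le_one_of_mem_cell {d : ℕ} {x : V d} {a b : Fin (d + 1) → ℤ} (ha : comb a ∈ cell x)
    (hb : comb b ∈ cell x) (i j : Fin (d + 1)) : (b - a) j - (b - a) i ≤ 1 := by
  have h1 := comb_mem_cell.1 hb i j _ (Int.le_ceil _)
  have h2 := comb_mem_cell.1 ha j i (-⌊x.1 j - x.1 i⌋) (by
    push_cast; linarith [Int.floor_le (x.1 j - x.1 i)])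
  have h3 := Int.ceil_le_floor_add_one (x.1 j - x.1 i)
  simp only [Pi.sub_apply]
  linarith

/-- Three lattice points with pairwise differences as above lie in a common face. -/
lemma exists_cell_of_sub_le_one {d : ℕ} {a b c : Fin (d + 1) → ℤ}
    (hab : ∀ i j, (b - a) j - (b - a) i ≤ 1) (hac : ∀ i j, (c - a) j - (c - a) i ≤ 1)
    (hbc : ∀ i j, (c - b) j - (c - b) i ≤ 1) :
    ∃ x : V d, comb a ∈ cell x ∧ comb b ∈ cell x ∧ comb c ∈ cell x := by
  -- The barycentre works: if one of three integers pairwise at distance at most 1 exceeds `m`,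
  -- their sum exceeds `3 * m`.
  refine ⟨(1 / 3 : ℝ) • (comb a + comb b + comb c), ?_⟩
  have h : ∀ (i j : Fin (d + 1)) (m : ℤ), ((1 / 3 : ℝ) • (comb a + comb b + comb c)).1 j -
      ((1 / 3 : ℝ) • (comb a + comb b + comb c)).1 i ≤ m →
      (a j - a i) + (b j - b i) + (c j - c i) ≤ 3 * m := by
    intro i j m hm
    have h1 := comb_apply_sub a i j
    have h2 := comb_apply_sub b i j
    have h3 := comb_apply_sub c i j
    simp only [Submodule.coe_smul, Submodule.coe_add, Pi.smul_apply, Pi.add_apply,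
      smul_eq_mul] at hm
    have : (((a j - a i : ℤ) : ℝ) + ((b j - b i : ℤ) : ℝ) + ((c j - c i : ℤ) : ℝ)) ≤ 3 * m := by
      linarith
    exact_mod_cast this
  simp only [Pi.sub_apply] at hab hac hbc
  refine ⟨comb_mem_cell.2 fun i j m hm => ?_, comb_mem_cell.2 fun i j m hm => ?_,
    comb_mem_cell.2 fun i j m hm => ?_⟩ <;>
  · have := h i j m hm
    have h1 := hab i j
    have h2 := hac i j
    have h3 := hbc i j
    have h4 := hab j i
    have h5 := hac j i
    have h6 := hbc j i
    omega

/-! ### Vertices of the quotient complex -/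

lemma comb_mem_sublattice {d : ℕ} (hd : 1 ≤ d) {k : Fin (d + 1) → ℕ} {a : Fin (d + 1) → ℤ} :
    comb a ∈ sublattice k ↔ a ∈ rowLattice k := by
  constructor
  · rintro ⟨b, hb⟩
    have h := add_mem (const_mem_rowLattice hd k (comb_eq_comb.1 hb))
      (show b ᵥ* M k ∈ rowLattice k from ⟨b, rfl⟩)
    rwa [sub_add_cancel] at h
  · rintro ⟨b, rfl⟩
    exact ⟨b, rfl⟩

/-- The class of a face. -/
abbrev faceClass {d : ℕ} (k : Fin (d + 1) → ℕ) (F : Face d) : Torus k :=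
  Quotient.mk (faceSetoid k) F

lemma exists_faceClass {d : ℕ} {k : Fin (d + 1) → ℕ} (A : Torus k) : ∃ F, A = faceClass k F :=
  (Quotient.exists_rep A).imp fun _ h => h.symm

/-- The class of the vertex `comb a`. -/
def vert {d : ℕ} (k : Fin (d + 1) → ℕ) (a : Fin (d + 1) → ℤ) : Torus k :=
  faceClass k ⟨cell (comb a), comb a, rfl⟩

lemma translate_cell {d : ℕ} (x : V d) (a : Fin (d + 1) → ℤ) :
    (fun y => y + comb a) '' cell x = cell (x + comb a) := by
  have := (constVAdd_mem (fun _ => 0) ⟨comb a, a, rfl⟩).1 x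
  simpa [add_comm] using this

lemma vert_eq_vert {d : ℕ} (hd : 1 ≤ d) {k : Fin (d + 1) → ℕ} {a b : Fin (d + 1) → ℤ} :
    vert k a = vert k b ↔ b - a ∈ rowLattice k := by
  have hsub : comb (b - a) = comb b - comb a := by rw [sub_eq_add_neg, comb_add, comb_neg]; abel
  constructor
  · intro h
    obtain ⟨v, hv, hv'⟩ := Quotient.exact h
    simp only [cell_comb, Set.image_singleton, Set.singleton_eq_singleton_iff] at hv'
    rwa [← comb_mem_sublattice hd, hsub, hv', add_sub_cancel_left]
  · intro h
    refine Quotient.sound ⟨comb (b - a), (comb_mem_sublattice hd).2 h, ?_⟩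
    simp only [cell_comb, Set.image_singleton, hsub, add_sub_cancel]

lemma vert_le_mk {d : ℕ} (hd : 1 ≤ d) {k : Fin (d + 1) → ℕ} {a : Fin (d + 1) → ℤ} {F : Face d} :
    vert k a ≤ faceClass k F ↔
      ∃ b, b - a ∈ rowLattice k ∧ comb b ∈ F.1 := by
  constructor
  · rintro ⟨F', G, hF, hG, hFG⟩
    obtain ⟨v, ⟨b, rfl⟩, hv'⟩ := Quotient.exact hF
    obtain ⟨u, ⟨c, rfl⟩, hu'⟩ := Quotient.exact hG
    refine ⟨a - b ᵥ* M k + c ᵥ* M k, ?_, ?_⟩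
    · have : a - b ᵥ* M k + c ᵥ* M k - a = (c - b) ᵥ* M k := by
        rw [Matrix.sub_vecMul]; abel
      rw [this]
      exact ⟨_, rfl⟩
    · rw [hu']
      have h1 : comb a ∈ cell (comb a) := mem_cell_self _
      change cell (comb a) = _ at hv'
      rw [hv'] at h1
      obtain ⟨y, hy, hya⟩ := h1
      refine ⟨y, hFG hy, ?_⟩
      simp only [sub_eq_add_neg, comb_add, comb_neg, ← hya]
      abel
  · rintro ⟨b, hb, hbF⟩
    refine ⟨⟨cell (comb b), comb b, rfl⟩, F, ((vert_eq_vert hd).2 hb).symm, rfl, ?_⟩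
    simpa [cell_comb] using hbF

lemma le_mk_of_subset {d : ℕ} {k : Fin (d + 1) → ℕ} {F G : Face d} (h : F.1 ⊆ G.1) :
    faceClass k F ≤ faceClass k G := ⟨F, G, rfl, rfl, h⟩

lemma exists_vert_le {d : ℕ} {k : Fin (d + 1) → ℕ} (A : Torus k) : ∃ a, vert k a ≤ A := by
  induction A using Quotient.inductionOn with
  | h F =>
    obtain ⟨_, x, rfl⟩ := F
    obtain ⟨a, ha, -⟩ := exists_comb_mem_cell x 0 0
    exact ⟨a, le_mk_of_subset (F := ⟨cell (comb a), _, rfl⟩) (G := ⟨cell x, _, rfl⟩)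
      (cell_subset ha)⟩

/-- A translate of a one-point face is a point, and faces are nonempty. This minimality is why order
automorphisms send vertices to vertices. -/
lemma eq_vert_of_le {d : ℕ} {k : Fin (d + 1) → ℕ} {A : Torus k} {a : Fin (d + 1) → ℤ}
    (h : A ≤ vert k a) : A = vert k a := by
  obtain ⟨F, G, rfl, hG, hFG⟩ := h
  obtain ⟨u, ⟨c, rfl⟩, hu⟩ := Quotient.exact hG
  rw [← hG]
  congr 1
  refine Subtype.ext (hFG.antisymm ?_)
  change cell (comb a) = _ at hu
  rw [cell_comb] at hu
  have hs : G.1.Subsingleton := by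
    intro y hy z hz
    have h1 : y + comb (c ᵥ* M k) ∈ ({comb a} : Set (V d)) := hu ▸ Set.mem_image_of_mem _ hy
    have h2 : z + comb (c ᵥ* M k) ∈ ({comb a} : Set (V d)) := hu ▸ Set.mem_image_of_mem _ hz
    exact add_right_cancel (h1.trans h2.symm)
  obtain ⟨x, hx⟩ := F.2
  have hxF : x ∈ F.1 := hx ▸ mem_cell_self x
  intro y hy
  rwa [hs hy (hFG hxF)]

/-- Relative to the common vertex `a`, vertices of either face have spread at most 1. Two of them in
the same class thus differ by a lattice vector of spread at most 2, which is constant, so they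
coincide. -/
lemma le_of_vert_le {d : ℕ} (hd : 1 ≤ d) {k : Fin (d + 1) → ℕ} (hk : ∀ i, 1 ≤ k i)
    {F : Face d} {G : Face d} {a : Fin (d + 1) → ℤ} (haF : comb a ∈ F.1) (haG : comb a ∈ G.1)
    (h : ∀ b, vert k b ≤ faceClass k F → vert k b ≤ faceClass k G) :
    F.1 ⊆ G.1 := by
  obtain ⟨_, x, rfl⟩ := F
  obtain ⟨_, y, rfl⟩ := G
  refine cell_subset_of_comb fun b hb => ?_
  obtain ⟨c, hc, hcG⟩ := (vert_le_mk hd).1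
    (h b ((vert_le_mk hd).2 ⟨b, by rw [sub_self]; exact zero_mem _, hb⟩))
  have heq : comb c = comb b := comb_eq_comb.2 <| eq_of_mem_rowLattice hd hk hc fun i j => by
    have h1 := sub_le_one_of_mem_cell haF hb j i
    have h2 := sub_le_one_of_mem_cell haG hcG i j
    simp only [Pi.sub_apply] at h1 h2 ⊢
    linarith
  rwa [← heq]

/-- A face class is determined by its vertices. -/
lemma eq_of_vert_le_iff {d : ℕ} (hd : 1 ≤ d) {k : Fin (d + 1) → ℕ} (hk : ∀ i, 1 ≤ k i)
    {A B : Torus k} (h : ∀ a, vert k a ≤ A ↔ vert k a ≤ B) : A = B := by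
  obtain ⟨a, ha⟩ := exists_vert_le A
  have ha' := (h a).1 ha
  obtain ⟨F, rfl⟩ := exists_faceClass A
  obtain ⟨G, rfl⟩ := exists_faceClass B
  obtain ⟨b, hb, hbF⟩ := (vert_le_mk hd).1 ha
  obtain ⟨c, hc, hcG⟩ := (vert_le_mk hd).1 ha'
  have hbc : b - c ∈ rowLattice k := by
    have := sub_mem hb hc
    rwa [sub_sub_sub_cancel_right] at this
  obtain ⟨_, y, rfl⟩ := G
  -- Another representative of the second class, translated so as to share the vertex `comb b` with
  -- the first.
  let G' : Face d := ⟨cell (y + comb (b - c)), _, rfl⟩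
  have hG : faceClass k ⟨cell y, y, rfl⟩ = faceClass k G' :=
    Quotient.sound ⟨comb (b - c), (comb_mem_sublattice hd).2 hbc, (translate_cell _ _).symm⟩
  have hbG : comb b ∈ G'.1 := by
    change comb b ∈ cell (y + comb (b - c))
    rw [← translate_cell]
    exact ⟨comb c, hcG, by simp only [← comb_add]; congr 1; abel⟩
  rw [hG] at h ⊢
  congr 1
  exact Subtype.ext ((le_of_vert_le hd hk hbF hbG fun l => (h l).1).antisymm
    (le_of_vert_le hd hk hbG hbF fun l => (h l).2))

/-- When a vertex and two of its neighbours lie in a common face. -/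
lemma exists_common_face {d : ℕ} (hd : 1 ≤ d) {k : Fin (d + 1) → ℕ} (hk : ∀ i, 1 ≤ k i)
    {a u v : Fin (d + 1) → ℤ} (hu : ∀ i j, u j - u i ≤ 1) (hv : ∀ i j, v j - v i ≤ 1) :
    (∃ A : Torus k, vert k a ≤ A ∧ vert k (a + u) ≤ A ∧ vert k (a + v) ≤ A) ↔
      ∀ i j, (v - u) j - (v - u) i ≤ 1 := by
  constructor
  · rintro ⟨A, h1, h2, h3⟩
    obtain ⟨⟨_, x, rfl⟩, rfl⟩ := exists_faceClass A
    obtain ⟨a', ha, ha'⟩ := (vert_le_mk hd).1 h1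
    have aux : ∀ u : Fin (d + 1) → ℤ, (∀ i j, u j - u i ≤ 1) →
        vert k (a + u) ≤ faceClass k ⟨cell x, x, rfl⟩ →
        ∃ b, comb b ∈ cell x ∧ ∀ i j, (b - a' - u) i = (b - a' - u) j := by
      intro u hu h2
      obtain ⟨b, hb, hb'⟩ := (vert_le_mk hd).1 h2
      -- Both `b - a'` and `u` have spread at most 1, so their difference, a lattice vector, is
      -- constant.
      refine ⟨b, hb', eq_of_mem_rowLattice hd hk (by
        have := sub_mem hb ha
        rwa [show b - (a + u) - (a' - a) = b - a' - u by abel] at this) fun i j => ?_⟩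
      have e1 := sub_le_one_of_mem_cell ha' hb' i j
      have e2 := hu j i
      simp only [Pi.sub_apply] at e1 ⊢
      linarith
    obtain ⟨b, hb, hb'⟩ := aux u hu h2
    obtain ⟨c, hc, hc'⟩ := aux v hv h3
    intro i j
    have e1 := sub_le_one_of_mem_cell hb hc i j
    have e2 := hb' i j
    have e3 := hc' i j
    simp only [Pi.sub_apply] at e1 e2 e3 ⊢
    linarith
  · intro h
    obtain ⟨x, h1, h2, h3⟩ := exists_cell_of_sub_le_one (a := a) (b := a + u) (c := a + v)
      (by simpa using hu) (by simpa using hv) (by simpa using h)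
    have key : ∀ {b}, comb b ∈ cell x → vert k b ≤ faceClass k ⟨cell x, x, rfl⟩ := fun hb =>
      (vert_le_mk hd).2 ⟨_, by rw [sub_self]; exact zero_mem _, hb⟩
    exact ⟨faceClass k ⟨cell x, x, rfl⟩, key h1, key h2, key h3⟩

/-! ### Automorphisms of the comparability graph of subsets -/

/-- Subsets and supersets of `I` are counted separately; only `I` is counted twice. This degree is
the invariant that recognises singletons up to complement. -/
lemma card_filter_comparable {ι : Type*} [Fintype ι] [DecidableEq ι] (I : Finset ι) :
    (Finset.univ.filter fun J : Finset ι => J ⊆ I ∨ I ⊆ J).card + 1 =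
      2 ^ I.card + 2 ^ (Fintype.card ι - I.card) := by
  rw [Finset.filter_or]
  have h1 : (Finset.univ.filter fun J : Finset ι => J ⊆ I) = I.powerset := by ext; simp
  have h2 : (Finset.univ.filter fun J : Finset ι => I ⊆ J) = Finset.Icc I Finset.univ := by
    ext; simp
  have h3 : I.powerset ∩ Finset.Icc I Finset.univ = {I} := by
    ext J
    simp only [Finset.mem_inter, Finset.mem_powerset, Finset.mem_Icc, Finset.mem_singleton]
    exact ⟨fun h => h.1.antisymm h.2.1, by rintro rfl; simp⟩
  rw [h1, h2, ← Finset.card_powerset, ← Finset.card_univ,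
    ← Finset.card_Icc_finset (Finset.subset_univ I), ← Finset.card_union_add_card_inter, h3,
    Finset.card_singleton]

/-- With `m = a + 1` and `n - m = b + 1`, the equation reads `(2 ^ a - 1) * (2 ^ b - 1) = 0`. -/
lemma eq_one_or_of_two_pow_add {n m : ℕ} (h0 : 0 < m) (hn : m < n)
    (h : 2 ^ m + 2 ^ (n - m) = 2 ^ 1 + 2 ^ (n - 1)) : m = 1 ∨ n - m = 1 := by
  obtain ⟨a, rfl⟩ : ∃ a, m = a + 1 := ⟨m - 1, by omega⟩
  obtain ⟨b, rfl⟩ : ∃ b, n = a + 1 + (b + 1) := ⟨n - (a + 1) - 1, by omega⟩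
  rw [show a + 1 + (b + 1) - (a + 1) = b + 1 by omega,
    show a + 1 + (b + 1) - 1 = a + b + 1 by omega] at h
  have h' : (2 : ℤ) ^ (a + 1) + 2 ^ (b + 1) = 2 ^ 1 + 2 ^ (a + b + 1) := by exact_mod_cast h
  have h2 : ((2 : ℤ) ^ a - 1) * (2 ^ b - 1) = 0 := by
    simp only [pow_succ, pow_add] at h'
    linarith
  have key : ∀ c : ℕ, (2 : ℤ) ^ c - 1 = 0 → c = 0 := by
    intro c hc
    by_contra hne
    have : (1 : ℤ) < 2 ^ c := one_lt_pow₀ (by norm_num) hne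
    linarith
  rcases mul_eq_zero.1 h2 with h3 | h3 <;> have := key _ h3 <;> omega

/-- For nonempty `I`, membership `i ∈ I` is the same as comparability of `{i}` with `I`, so the
images of singletons determine `g`. -/
lemma exists_perm_of_singleton {ι : Type*} [Fintype ι] [DecidableEq ι]
    {g : Finset ι → Finset ι} (hg : Function.Injective g)
    (hne : ∀ I, I ≠ ∅ → I ≠ Finset.univ → g I ≠ ∅)
    (hcomp : ∀ I J, (I ⊆ J ∨ J ⊆ I) ↔ (g I ⊆ g J ∨ g J ⊆ g I))
    (hs : ∀ i, ∃ j, g {i} = {j}) :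
    ∃ σ : Equiv.Perm ι, ∀ I, I ≠ ∅ → I ≠ Finset.univ → g I = I.map σ.toEmbedding := by
  choose s hs using hs
  have hinj : Function.Injective s := fun i j h =>
    Finset.singleton_injective (hg (by rw [hs, hs, h]))
  let σ := Equiv.ofBijective s (Finite.injective_iff_bijective.1 hinj)
  have aux : ∀ (i : ι) (I : Finset ι), I ≠ ∅ → (({i} ⊆ I ∨ I ⊆ {i}) ↔ i ∈ I) := by
    intro i I hI
    rw [Finset.singleton_subset_iff, Finset.subset_singleton_iff]
    refine ⟨?_, Or.inl⟩
    rintro (h | h | h)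
    · exact h
    · exact absurd h hI
    · simp [h]
  refine ⟨σ, fun I h1 h2 => ?_⟩
  ext j
  obtain ⟨i, rfl⟩ := σ.surjective j
  rw [← aux (σ i) _ (hne I h1 h2), show ({σ i} : Finset ι) = g {i} from (hs i).symm, ← hcomp,
    aux i I h1]
  simp

/-- By degree, a singleton goes to a singleton or to the complement of one. The types cannot mix:
incomparability would force `{a}` and `{a}ᶜ`, and a third singleton would have no image left. -/
lemma exists_perm_of_comparable_iff {ι : Type*} [Fintype ι] [DecidableEq ι]
    (h3 : 3 ≤ Fintype.card ι) {g : Finset ι → Finset ι} (hg : Function.Injective g)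
    (hempty : g ∅ = ∅) (huniv : g Finset.univ = Finset.univ)
    (hcomp : ∀ I J, (I ⊆ J ∨ J ⊆ I) ↔ (g I ⊆ g J ∨ g J ⊆ g I)) :
    ∃ σ : Equiv.Perm ι, (∀ I, I ≠ ∅ → I ≠ Finset.univ → g I = I.map σ.toEmbedding) ∨
      ∀ I, I ≠ ∅ → I ≠ Finset.univ → g I = (I.map σ.toEmbedding)ᶜ := by
  have hne : ∀ I, I ≠ ∅ → g I ≠ ∅ := fun I h h' => h (hg (h'.trans hempty.symm))
  have hnu : ∀ I, I ≠ Finset.univ → g I ≠ Finset.univ :=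
    fun I h h' => h (hg (h'.trans huniv.symm))
  have hdeg : ∀ I, 2 ^ (g I).card + 2 ^ (Fintype.card ι - (g I).card) =
      2 ^ I.card + 2 ^ (Fintype.card ι - I.card) := by
    intro I
    rw [← card_filter_comparable, ← card_filter_comparable]
    congr 1
    refine (Finset.card_bijective g (Finite.injective_iff_bijective.1 hg) fun J => ?_).symm
    simp only [Finset.mem_filter, Finset.mem_univ, true_and]
    exact hcomp J I
  have hsing : ∀ i, (∃ j, g {i} = {j}) ∨ ∃ j, g {i} = {j}ᶜ := by
    intro i
    have hu : ({i} : Finset ι) ≠ Finset.univ := fun h => by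
      have := congrArg Finset.card h
      rw [Finset.card_singleton, Finset.card_univ] at this
      omega
    have hd := hdeg {i}
    rw [Finset.card_singleton] at hd
    rcases eq_one_or_of_two_pow_add (Finset.card_pos.2 (Finset.nonempty_iff_ne_empty.2
      (hne _ (Finset.singleton_ne_empty i)))) ((Finset.card_lt_iff_ne_univ _).2 (hnu _ hu)) hd
      with h | h
    · exact Or.inl (Finset.card_eq_one.1 h)
    · rw [← Finset.card_compl] at h
      obtain ⟨j, hj⟩ := Finset.card_eq_one.1 h
      exact Or.inr ⟨j, by rw [← hj, compl_compl]⟩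
  have hinc : ∀ i j, i ≠ j → ¬ (g {i} ⊆ g {j} ∨ g {j} ⊆ g {i}) := by
    intro i j hij h
    rw [← hcomp, Finset.singleton_subset_singleton, Finset.singleton_subset_singleton] at h
    exact hij (h.elim id Eq.symm)
  have hmix : ∀ i j a b, i ≠ j → g {i} = {a} → g {j} = {b}ᶜ → a = b := by
    intro i j a b hij ha hb
    by_contra hab
    exact hinc i j hij (Or.inl (by rw [ha, hb]; simpa using Ne.symm hab))
  have hno : ∀ i j a b, i ≠ j → g {i} = {a} → g {j} = {b}ᶜ → False := by
    intro i j a b hij ha hb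
    obtain ⟨l, hl⟩ : ∃ l, l ∉ ({i, j} : Finset ι) := by
      by_contra! hcon
      have h1 : Finset.univ.card ≤ ({i, j} : Finset ι).card :=
        Finset.card_le_card fun l _ => hcon l
      have := Finset.card_le_two (a := i) (b := j)
      rw [Finset.card_univ] at h1
      omega
    simp only [Finset.mem_insert, Finset.mem_singleton, not_or] at hl
    have hab := hmix i j a b hij ha hb
    rcases hsing l with ⟨c, hc⟩ | ⟨c, hc⟩
    · have := hmix l j c b hl.2 hc hb
      exact hl.1 (Finset.singleton_injective (hg (by rw [hc, ha, this, hab])))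
    · have := hmix i l a c (Ne.symm hl.1) ha hc
      exact hl.2 (Finset.singleton_injective (hg (by rw [hc, hb, ← this, hab])))
  by_cases hall : ∀ i, ∃ j, g {i} = {j}
  · obtain ⟨σ, hσ⟩ := exists_perm_of_singleton hg (fun I h _ => hne I h) hcomp hall
    exact ⟨σ, Or.inl hσ⟩
  · obtain ⟨j, hj⟩ := not_forall.1 hall
    obtain ⟨b, hb⟩ := (hsing j).resolve_left hj
    have hall' : ∀ i, ∃ j, (g {i})ᶜ = {j} := by
      intro i
      rcases hsing i with ⟨a, ha⟩ | ⟨a, ha⟩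
      · by_cases hij : i = j
        · exact absurd ⟨a, hij ▸ ha⟩ hj
        · exact (hno i j a b hij ha hb).elim
      · exact ⟨a, by rw [ha, compl_compl]⟩
    obtain ⟨σ, hσ⟩ := exists_perm_of_singleton (g := fun I => (g I)ᶜ)
      (fun I J h => hg (compl_injective h))
      (fun I _ h h' => hnu I h (by simpa using h'))
      (fun I J => by rw [hcomp, Finset.compl_subset_compl, Finset.compl_subset_compl, or_comm])
      hall'
    exact ⟨σ, Or.inr fun I h1 h2 => by rw [← hσ I h1 h2, compl_compl]⟩

/-! ### Automorphisms on vertices -/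

/-- The indicator vector of a set of indices. -/
def ind {d : ℕ} (I : Finset (Fin (d + 1))) : Fin (d + 1) → ℤ := fun i => if i ∈ I then 1 else 0

lemma ind_empty {d : ℕ} : ind (∅ : Finset (Fin (d + 1))) = 0 := by ext; simp [ind]

lemma ind_singleton {d : ℕ} (i : Fin (d + 1)) : ind {i} = Pi.single i 1 := by
  ext j; simp [ind, Pi.single_apply]

lemma ind_pair {d : ℕ} {i j : Fin (d + 1)} (h : i ≠ j) :
    ind {i, j} = Pi.single i 1 + Pi.single j 1 := by
  ext l
  simp only [ind, Finset.mem_insert, Finset.mem_singleton, Pi.add_apply, Pi.single_apply]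
  by_cases h1 : l = i
  · subst h1; simp [h]
  · simp [h1]

lemma ind_compl {d : ℕ} (I : Finset (Fin (d + 1))) : ind Iᶜ = 1 - ind I := by
  ext l
  by_cases h : l ∈ I <;> simp [ind, h]

lemma ind_sub_le_one {d : ℕ} (I : Finset (Fin (d + 1))) (i j : Fin (d + 1)) :
    ind I j - ind I i ≤ 1 := by
  simp only [ind]; split_ifs <;> simp

lemma ind_sub_ind_le_one_iff {d : ℕ} {I J : Finset (Fin (d + 1))} :
    (∀ i j, (ind J - ind I) j - (ind J - ind I) i ≤ 1) ↔ I ⊆ J ∨ J ⊆ I := by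
  constructor
  · intro h
    by_contra! hcon
    obtain ⟨i, hi, hi'⟩ := Finset.not_subset.1 hcon.1
    obtain ⟨j, hj, hj'⟩ := Finset.not_subset.1 hcon.2
    have := h i j
    simp [ind, hi, hi', hj, hj'] at this
  · rintro (h | h) i j <;> have h1 := @h i <;> have h2 := @h j <;>
    · simp only [ind, Pi.sub_apply]
      split_ifs <;> simp_all

lemma exists_ind {d : ℕ} {u : Fin (d + 1) → ℤ} (hu : ∀ i j, u j - u i ≤ 1) :
    ∃ I : Finset (Fin (d + 1)), ∀ i j, (u - ind I) i = (u - ind I) j := by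
  obtain ⟨m, hm⟩ := Finite.exists_min u
  have h : ∀ i, (u - ind (Finset.univ.filter fun l => u l ≠ u m)) i = u m := by
    intro i
    have h1 := hu m i
    have h2 := hm i
    simp only [Pi.sub_apply, ind, Finset.mem_filter, Finset.mem_univ, true_and]
    split_ifs <;> omega
  exact ⟨_, fun i j => by rw [h, h]⟩

lemma eq_of_ind_sub_mem {d : ℕ} (hd : 1 ≤ d) {k : Fin (d + 1) → ℕ} (hk : ∀ i, 1 ≤ k i)
    {I J : Finset (Fin (d + 1))} (h : ind I - ind J ∈ rowLattice k) :
    I = J ∨ (I = ∅ ∧ J = Finset.univ) ∨ I = Finset.univ ∧ J = ∅ := by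
  have hc := eq_of_mem_rowLattice hd hk h fun i j => by
    have h1 := ind_sub_le_one I i j
    have h2 := ind_sub_le_one J j i
    simp only [Pi.sub_apply]
    linarith
  simp only [Pi.sub_apply, ind] at hc
  by_cases hIJ : I = J
  · exact Or.inl hIJ
  refine Or.inr ?_
  obtain ⟨l, hl⟩ : ∃ l, ¬ (l ∈ I ↔ l ∈ J) := by
    by_contra! hcon
    exact hIJ (Finset.ext hcon)
  by_cases hlI : l ∈ I
  · have hlJ : l ∉ J := fun h => hl (by simp [h, hlI])
    refine Or.inr ⟨Finset.eq_univ_iff_forall.2 fun i => ?_,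
      Finset.eq_empty_iff_forall_notMem.2 fun i => ?_⟩ <;>
    · have := hc l i
      rw [if_pos hlI, if_neg hlJ] at this
      split_ifs at this <;> simp_all
  · have hlJ : l ∈ J := by by_contra h; exact hl (by simp [h, hlI])
    refine Or.inl ⟨Finset.eq_empty_iff_forall_notMem.2 fun i => ?_,
      Finset.eq_univ_iff_forall.2 fun i => ?_⟩ <;>
    · have := hc l i
      rw [if_neg hlI, if_pos hlJ] at this
      split_ifs at this <;> simp_all

/-- The difference has spread at most 2, hence is constant. As `d ≥ 2`, some coordinate avoids `p`
and `q`, so the constant is 0. -/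
lemma eq_of_smul_single_sub_mem {d : ℕ} (hd : 2 ≤ d) {k : Fin (d + 1) → ℕ} (hk : ∀ i, 1 ≤ k i)
    {ε ε' : ℤˣ} {p q : Fin (d + 1)}
    (h : (ε : ℤ) • (Pi.single p 1 : Fin (d + 1) → ℤ) - (ε' : ℤ) • Pi.single q 1 ∈ rowLattice k) :
    ε = ε' ∧ p = q := by
  have hε := Int.units_eq_one_or ε
  have hε' := Int.units_eq_one_or ε'
  have hb : ∀ (ε : ℤˣ) (p i j : Fin (d + 1)), ((ε : ℤ) • (Pi.single p 1 : Fin (d + 1) → ℤ)) j -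
      ((ε : ℤ) • (Pi.single p 1 : Fin (d + 1) → ℤ)) i ≤ 1 := by
    intro ε p i j
    rcases Int.units_eq_one_or ε with rfl | rfl <;>
      simp only [Pi.smul_apply, Pi.single_apply, smul_eq_mul] <;> split_ifs <;> simp
  have hc := eq_of_mem_rowLattice (by omega) hk h fun i j => by
    have h1 := hb ε p i j
    have h2 := hb ε' q j i
    simp only [Pi.sub_apply]
    linarith
  obtain ⟨l, hl⟩ : ∃ l, l ∉ ({p, q} : Finset (Fin (d + 1))) := by
    by_contra! hcon
    have h1 : Finset.univ.card ≤ ({p, q} : Finset (Fin (d + 1))).card :=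
      Finset.card_le_card fun l _ => hcon l
    have := Finset.card_le_two (a := p) (b := q)
    rw [Finset.card_univ, Fintype.card_fin] at h1
    omega
  simp only [Finset.mem_insert, Finset.mem_singleton, not_or] at hl
  have h1 := hc p l
  simp only [Pi.sub_apply, Pi.smul_apply, Pi.single_apply, if_true, if_neg hl.1, if_neg hl.2,
    smul_eq_mul, mul_one, mul_zero, sub_zero] at h1
  by_cases hpq : p = q
  · rw [if_pos hpq, mul_one] at h1
    exact ⟨Units.ext (by linarith), hpq⟩
  · rw [if_neg hpq, mul_zero, sub_zero] at h1
    exact absurd h1 ε.ne_zero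

lemma exists_apply_vert {d : ℕ} {k : Fin (d + 1) → ℕ} (φ : Aut k) (a : Fin (d + 1) → ℤ) :
    ∃ b, φ (vert k a) = vert k b := by
  obtain ⟨b, hb⟩ := exists_vert_le (φ (vert k a))
  have := eq_vert_of_le ((φ.symm_apply_le).2 hb)
  exact ⟨b, by rw [← this, OrderIso.apply_symm_apply]⟩

lemma aut_ext {d : ℕ} (hd : 1 ≤ d) {k : Fin (d + 1) → ℕ} (hk : ∀ i, 1 ≤ k i) {φ ψ : Aut k}
    (h : ∀ a, φ (vert k a) = ψ (vert k a)) : φ = ψ := by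
  have hs : ∀ a, φ.symm (vert k a) = ψ.symm (vert k a) := by
    intro a
    obtain ⟨b, hb⟩ := exists_apply_vert φ.symm a
    rw [hb, OrderIso.eq_symm_apply ψ, ← h, ← hb, OrderIso.apply_symm_apply]
  ext A
  refine eq_of_vert_le_iff hd hk fun a => ?_
  rw [← φ.symm_apply_le, ← ψ.symm_apply_le, hs]

/-- An automorphism maps neighbours of a vertex to neighbours. -/
lemma exists_apply_vert_add_ind {d : ℕ} (hd : 1 ≤ d) {k : Fin (d + 1) → ℕ} (hk : ∀ i, 1 ≤ k i)
    {φ : Aut k} {a c : Fin (d + 1) → ℤ} (hac : φ (vert k a) = vert k c)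
    (I : Finset (Fin (d + 1))) : ∃ J, φ (vert k (a + ind I)) = vert k (c + ind J) := by
  obtain ⟨A, h1, h2, -⟩ := (exists_common_face (a := a) hd hk (ind_sub_le_one I)
    (ind_sub_le_one I)).2 (by simp)
  obtain ⟨b, hb⟩ := exists_apply_vert φ (a + ind I)
  rw [← φ.le_iff_le, hac] at h1
  rw [← φ.le_iff_le, hb] at h2
  obtain ⟨⟨_, x, rfl⟩, hF⟩ := exists_faceClass (φ A)
  rw [hF] at h1 h2
  obtain ⟨c', hc, hc'⟩ := (vert_le_mk hd).1 h1
  obtain ⟨b', hb1, hb'⟩ := (vert_le_mk hd).1 h2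
  obtain ⟨J, hJ⟩ := exists_ind (sub_le_one_of_mem_cell hc' hb')
  refine ⟨J, hb.trans ((vert_eq_vert hd).2 ?_)⟩
  have := sub_mem (sub_mem hb1 hc) (const_mem_rowLattice hd k hJ)
  rwa [show b' - b - (c' - c) - (b' - c' - ind J) = c + ind J - b by abel] at this

/-- Around a vertex, an automorphism acts as a permutation of the `w i`, up to sign. -/
lemma exists_local_perm {d : ℕ} (hd : 2 ≤ d) {k : Fin (d + 1) → ℕ} (hk : ∀ i, 1 ≤ k i)
    {φ : Aut k} {a c : Fin (d + 1) → ℤ} (hac : φ (vert k a) = vert k c) :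
    ∃ (ε : ℤˣ) (σ : Equiv.Perm (Fin (d + 1))), ∀ I : Finset (Fin (d + 1)), I ≠ ∅ →
      I ≠ Finset.univ →
        φ (vert k (a + ind I)) = vert k (c + (ε : ℤ) • ind (I.map σ.toEmbedding)) := by
  have hd1 : 1 ≤ d := by omega
  choose g0 hg0 using exists_apply_vert_add_ind hd1 hk hac
  -- The empty and the full set both represent the central vertex, so `g0` may confuse them; fixing
  -- both makes `g` injective.
  let g : Finset (Fin (d + 1)) → Finset (Fin (d + 1)) := fun I =>
    if I = ∅ then ∅ else if I = Finset.univ then Finset.univ else g0 I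
  have hne : (Finset.univ : Finset (Fin (d + 1))) ≠ ∅ := Finset.univ_nonempty.ne_empty
  have hempty : g ∅ = ∅ := if_pos rfl
  have huniv : g Finset.univ = Finset.univ := (if_neg hne).trans (if_pos rfl)
  have hvu : ∀ a, vert k (a + ind Finset.univ) = vert k a := fun a =>
    (vert_eq_vert hd1).2 (const_mem_rowLattice hd1 k fun i j => by simp [ind])
  have hg : ∀ I, φ (vert k (a + ind I)) = vert k (c + ind (g I)) := by
    intro I
    by_cases h1 : I = ∅
    · rw [h1, hempty, ind_empty, add_zero, add_zero, hac]
    by_cases h2 : I = Finset.univ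
    · rw [h2, huniv, hvu, hvu, hac]
    · rw [hg0]; simp [g, h1, h2]
  have hsub : ∀ I J, g I = g J → ind I - ind J ∈ rowLattice k := by
    intro I J h
    have := φ.injective ((hg I).trans ((congrArg (fun K => vert k (c + ind K)) h).trans (hg J).symm))
    have := (vert_eq_vert hd1).1 this.symm
    rwa [add_sub_add_left_eq_sub] at this
  have hinj : Function.Injective g := by
    intro I J h
    rcases eq_of_ind_sub_mem hd1 hk (hsub I J h) with h1 | ⟨rfl, rfl⟩ | ⟨rfl, rfl⟩
    · exact h1
    · rw [hempty, huniv] at h; exact absurd h.symm hne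
    · rw [hempty, huniv] at h; exact absurd h hne
  have hcomp : ∀ I J, (I ⊆ J ∨ J ⊆ I) ↔ (g I ⊆ g J ∨ g J ⊆ g I) := by
    intro I J
    rw [← ind_sub_ind_le_one_iff, ← ind_sub_ind_le_one_iff,
      ← exists_common_face (a := a) hd1 hk (ind_sub_le_one I) (ind_sub_le_one J),
      ← exists_common_face (a := c) hd1 hk (ind_sub_le_one (g I)) (ind_sub_le_one (g J)),
      ← hg, ← hg, ← hac]
    constructor
    · rintro ⟨A, h1, h2, h3⟩
      exact ⟨φ A, φ.le_iff_le.2 h1, φ.le_iff_le.2 h2, φ.le_iff_le.2 h3⟩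
    · rintro ⟨A, h1, h2, h3⟩
      exact ⟨φ.symm A, (φ.le_symm_apply).2 h1, (φ.le_symm_apply).2 h2, (φ.le_symm_apply).2 h3⟩
  obtain ⟨σ, hσ | hσ⟩ := exists_perm_of_comparable_iff (by simpa using hd) hinj hempty huniv hcomp
  · exact ⟨1, σ, fun I h1 h2 => by rw [hg, hσ I h1 h2]; simp⟩
  -- The indicator of a complement is the negated indicator plus the constant 1, which disappears in
  -- the quotient.
  · refine ⟨-1, σ, fun I h1 h2 => ?_⟩
    rw [hg, hσ I h1 h2, ind_compl]
    refine (vert_eq_vert hd1).2 (const_mem_rowLattice hd1 k fun i j => ?_)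
    simp only [Units.val_neg, Units.val_one, Pi.sub_apply, Pi.add_apply, Pi.smul_apply,
      Pi.one_apply, smul_eq_mul]
    ring

lemma mem_of_single_mem {ι : Type*} [Fintype ι] [DecidableEq ι] {H : AddSubgroup (ι → ℤ)}
    (h : ∀ i, Pi.single i 1 ∈ H) (v : ι → ℤ) : v ∈ H := by
  rw [← Finset.univ_sum_single v]
  refine sum_mem fun i _ => ?_
  have := H.zsmul_mem (h i) (v i)
  rwa [← Pi.single_smul, smul_eq_mul, mul_one] at this

/-- Every automorphism is given on vertices by a signed permutation and a translation. -/
lemma exists_apply_vert_eq {d : ℕ} (hd : 2 ≤ d) {k : Fin (d + 1) → ℕ} (hk : ∀ i, 1 ≤ k i)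
    (φ : Aut k) : ∃ (c : Fin (d + 1) → ℤ) (ε : ℤˣ) (σ : Equiv.Perm (Fin (d + 1))),
      ∀ a, φ (vert k a) = vert k (c + (ε : ℤ) • fun i => a (σ.symm i)) := by
  have hd1 : 1 ≤ d := by omega
  choose f hf using exists_apply_vert φ
  choose ε σ hloc using fun a => exists_local_perm hd hk (hf a)
  have hsu : ∀ i : Fin (d + 1), ({i} : Finset (Fin (d + 1))) ≠ Finset.univ := fun i h => by
    have := congrArg Finset.card h
    rw [Finset.card_singleton, Finset.card_univ, Fintype.card_fin] at this
    omega
  have hpu : ∀ i j : Fin (d + 1), ({i, j} : Finset (Fin (d + 1))) ≠ Finset.univ := fun i j h => by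
    have := congrArg Finset.card h
    have h2 := Finset.card_le_two (a := i) (b := j)
    rw [Finset.card_univ, Fintype.card_fin] at this
    omega
  have hone : ∀ a i, φ (vert k (a + Pi.single i 1)) =
      vert k (f a + (ε a : ℤ) • Pi.single (σ a i) 1) := by
    intro a i
    have := hloc a {i} (Finset.singleton_ne_empty i) (hsu i)
    rwa [ind_singleton, Finset.map_singleton, ind_singleton] at this
  have hpair : ∀ a i j, i ≠ j → φ (vert k (a + Pi.single i 1 + Pi.single j 1)) =
      vert k (f a + (ε a : ℤ) • (Pi.single (σ a i) 1 + Pi.single (σ a j) 1)) := by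
    intro a i j hij
    have := hloc a {i, j} (Finset.insert_ne_empty _ _) (hpu i j)
    rwa [ind_pair hij, Finset.map_insert, Finset.map_singleton, ind_pair (by simpa using hij),
      ← add_assoc] at this
  have hstep : ∀ a i, (ε (a + Pi.single i 1), σ (a + Pi.single i 1)) = (ε a, σ a) := by
    intro a i
    have h1 := (vert_eq_vert hd1).1 ((hone a i).symm.trans (hf _))
    -- The image of `a + e_i + e_j` is computed around `a` and around `a + e_i`; comparing the two
    -- identifies the image of direction `j`.
    have h2 : ∀ j, j ≠ i → ε a = ε (a + Pi.single i 1) ∧ σ a j = σ (a + Pi.single i 1) j := by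
      intro j hj
      have h3 := (vert_eq_vert hd1).1 ((hone (a + Pi.single i 1) j).symm.trans
        (hpair a i j hj.symm))
      refine eq_of_smul_single_sub_mem hd hk ?_
      have h4 := add_mem h1 h3
      rw [smul_add] at h4
      convert h4 using 1
      abel
    have h5 : σ a = σ (a + Pi.single i 1) := by
      ext1 j
      by_cases hj : j = i
      -- The direction `i` itself is settled by bijectivity, since the permutations agree at all
      -- other indices.
      · by_contra hne
        obtain ⟨l, hl⟩ := (σ a).surjective (σ (a + Pi.single i 1) j)
        have hlj : l ≠ j := fun h => hne (by rw [← hl, h])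
        exact hlj ((σ (a + Pi.single i 1)).injective (by
          rw [← (h2 l (hj ▸ hlj)).2, hl]))
      · exact (h2 j hj).2
    have h6 := (h2 (i + 1) (add_one_ne_self hd1 i)).1
    rw [← h5, ← h6]
  have hconst : ∀ a, (ε a, σ a) = (ε 0, σ 0) := by
    -- The translations that leave the local sign and permutation unchanged at every vertex form a
    -- subgroup; it contains the unit vectors.
    let H : AddSubgroup (Fin (d + 1) → ℤ) :=
      { carrier := {v | ∀ a, (ε (a + v), σ (a + v)) = (ε a, σ a)}
        zero_mem' := fun a => by rw [add_zero]
        add_mem' := fun {u v} hu hv a => by rw [← add_assoc, hv, hu]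
        neg_mem' := fun {v} hv a => by rw [← hv (a + -v), neg_add_cancel_right] }
    intro a
    have : a ∈ H := mem_of_single_mem (H := H) (fun i a => hstep a i) a
    rw [← this 0, zero_add]
  have hε : ∀ a, ε a = ε 0 := fun a => congrArg Prod.fst (hconst a)
  have hσ : ∀ a, σ a = σ 0 := fun a => congrArg Prod.snd (hconst a)
  refine ⟨f 0, ε 0, σ 0, ?_⟩
  let P : (Fin (d + 1) → ℤ) →+ (Fin (d + 1) → ℤ) :=
    { toFun := fun a => ((ε 0 : ℤˣ) : ℤ) • fun i => a ((σ 0).symm i)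
      map_zero' := by ext; simp
      map_add' := fun a b => by ext; simp [mul_add] }
  have hvert : ∀ a, vert k (f a) = vert k (f 0 + P a) := by
    let H : AddSubgroup (Fin (d + 1) → ℤ) :=
      { carrier := {v | ∀ a, f (a + v) - f a - P v ∈ rowLattice k}
        zero_mem' := fun a => by rw [add_zero, map_zero, sub_self, sub_zero]; exact zero_mem _
        add_mem' := fun {u v} hu hv a => by
          have := add_mem (hu a) (hv (a + u))
          rw [← add_assoc, map_add]
          convert this using 1
          abel
        neg_mem' := fun {v} hv a => by
          have := neg_mem (hv (a + -v))
          rw [neg_add_cancel_right] at this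
          rw [map_neg]
          convert this using 1
          abel }
    intro a
    have : a ∈ H := mem_of_single_mem (H := H) (fun i a => by
      have h1 := (vert_eq_vert hd1).1 ((hone a i).symm.trans (hf _))
      have h2 : P (Pi.single i 1) = (ε a : ℤ) • Pi.single (σ a i) 1 := by
        rw [hε, hσ]
        ext j
        simp [P, Pi.single_apply, Equiv.symm_apply_eq]
      rw [h2]
      convert h1 using 1
      abel) a
    refine ((vert_eq_vert hd1).2 ?_).symm
    have h3 := this 0
    rw [zero_add] at h3
    convert h3 using 1
    abel
  intro a
  rw [hf, hvert]
  rfl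

/-! ### The automorphism group -/

lemma induced_vert {d : ℕ} {k : Fin (d + 1) → ℕ} (g : symmetries k) {a b : Fin (d + 1) → ℤ}
    (h : g.1 (comb a) = comb b) : induced k g (vert k a) = vert k b := by
  refine congrArg (faceClass k) (Subtype.ext ?_)
  change g.1 '' cell (comb a) = cell (comb b)
  rw [g.2.1, h]

lemma translation_vert {d : ℕ} {k : Fin (d + 1) → ℕ} (c a : Fin (d + 1) → ℤ) :
    translation k ⟨comb c, c, rfl⟩ (vert k a) = vert k (c + a) :=
  induced_vert _ (comb_add c a).symm

lemma R_vert {d : ℕ} {k : Fin (d + 1) → ℕ} (a : Fin (d + 1) → ℤ) :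
    R k (vert k a) = vert k (-a) :=
  induced_vert _ (comb_neg a).symm

lemma shift_vert {d : ℕ} {k : Fin (d + 1) → ℕ} (σ : shiftStabilizer k) (a : Fin (d + 1) → ℤ) :
    shift k σ (vert k a) = vert k fun i => a (σ.1.symm i) :=
  induced_vert _ (permV_comb σ.1 a)

/-- The automorphism composed of a shift, a power of `R` and a translation. -/
def compound {d : ℕ} (k : Fin (d + 1) → ℕ) (c : Fin (d + 1) → ℤ) (ε : ℤˣ)
    (σ : shiftStabilizer k) : Aut k :=
  translation k ⟨comb c, c, rfl⟩ * ((if ε = 1 then 1 else R k) * shift k σ)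

lemma compound_vert {d : ℕ} {k : Fin (d + 1) → ℕ} (c : Fin (d + 1) → ℤ) (ε : ℤˣ)
    (σ : shiftStabilizer k) (a : Fin (d + 1) → ℤ) :
    compound k c ε σ (vert k a) = vert k (c + (ε : ℤ) • fun i => a (σ.1.symm i)) := by
  rw [compound, RelIso.mul_apply, RelIso.mul_apply, shift_vert]
  rcases Int.units_eq_one_or ε with rfl | rfl
  · rw [if_pos rfl, RelIso.one_apply, translation_vert, Units.val_one, one_smul]
  · rw [if_neg (by decide), R_vert, translation_vert, Units.val_neg, Units.val_one, neg_one_smul]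

lemma compound_mem_closure {d : ℕ} (k : Fin (d + 1) → ℕ) (c : Fin (d + 1) → ℤ) (ε : ℤˣ)
    (σ : shiftStabilizer k) : compound k c ε σ ∈ Subgroup.closure
      (Set.range (translation k) ∪ {R k} ∪ Set.range (shift k)) := by
  refine mul_mem (Subgroup.subset_closure (Or.inl (Or.inl ⟨_, rfl⟩)))
    (mul_mem ?_ (Subgroup.subset_closure (Or.inr ⟨_, rfl⟩)))
  split_ifs
  · exact one_mem _
  · exact Subgroup.subset_closure (Or.inl (Or.inr rfl))

lemma exists_eq_compound {d : ℕ} (hd : 2 ≤ d) {k : Fin (d + 1) → ℕ} (hk : ∀ i, 1 ≤ k i)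
    (φ : Aut k) : ∃ c ε σ, φ = compound k c ε σ := by
  have hd1 : 1 ≤ d := by omega
  obtain ⟨c, ε, σ, h⟩ := exists_apply_vert_eq hd hk φ
  have hσ : σ ∈ shiftStabilizer k := by
    refine mem_shiftStabilizer hd hk fun v hv => ?_
    -- A lattice vector represents the class of 0, so its image represents the class of `c`;
    -- multiplying by `ε` once more removes the sign.
    have h1 : vert k 0 = vert k v := (vert_eq_vert hd1).2 (by simpa using hv)
    have h2 := congrArg φ h1
    rw [h, h, vert_eq_vert hd1, add_sub_add_left_eq_sub] at h2
    have h3 := (rowLattice k).smul_mem (ε : ℤ) h2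
    rw [← smul_sub, smul_smul, Int.units_coe_mul_self, one_smul] at h3
    convert h3 using 1
    ext i
    simp
  exact ⟨c, ε, ⟨σ, hσ⟩, aut_ext hd1 hk fun a => by rw [h, compound_vert]⟩

lemma compound_eq_compound {d : ℕ} (hd : 2 ≤ d) {k : Fin (d + 1) → ℕ} (hk : ∀ i, 1 ≤ k i)
    {c c' : Fin (d + 1) → ℤ} {ε ε' : ℤˣ} {σ σ' : shiftStabilizer k} :
    compound k c ε σ = compound k c' ε' σ' ↔ c' - c ∈ rowLattice k ∧ ε = ε' ∧ σ = σ' := by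
  have hd1 : 1 ≤ d := by omega
  constructor
  · intro h
    have h1 : ∀ a, _ := fun a => congrArg (fun φ : Aut k => φ (vert k a)) h
    simp only [compound_vert] at h1
    have h0 : c' - c ∈ rowLattice k := by
      have := (vert_eq_vert hd1).1 (h1 0)
      convert this using 1
      ext; simp
    -- Once the translation parts agree modulo the lattice, the images of unit vectors reveal sign
    -- and permutation.
    have h2 : ∀ i, ε' = ε ∧ σ'.1 i = σ.1 i := by
      intro i
      refine eq_of_smul_single_sub_mem hd hk ?_
      have := sub_mem ((vert_eq_vert hd1).1 (h1 (Pi.single i 1))) h0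
      convert this using 1
      ext j
      simp only [Pi.sub_apply, Pi.add_apply, Pi.smul_apply, Pi.single_apply, Equiv.symm_apply_eq]
      ring
    exact ⟨h0, (h2 0).1.symm, Subtype.ext (Equiv.ext fun i => (h2 i).2.symm)⟩
  · rintro ⟨h, rfl, rfl⟩
    refine aut_ext hd1 hk fun a => ?_
    rw [compound_vert, compound_vert, vert_eq_vert hd1, add_sub_add_right_eq_sub]
    exact h

lemma card_aut {d : ℕ} (hd : 2 ≤ d) {k : Fin (d + 1) → ℕ} (hk : ∀ i, 1 ≤ k i) :
    Nat.card (Aut k) = Nat.card ((Fin (d + 1) → ℤ) ⧸ rowLattice k) *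
      (2 * Nat.card (shiftStabilizer k)) := by
  let f : ((Fin (d + 1) → ℤ) ⧸ rowLattice k) × ℤˣ × shiftStabilizer k → Aut k :=
    fun x => compound k x.1.out x.2.1 x.2.2
  have hout : ∀ q : (Fin (d + 1) → ℤ) ⧸ rowLattice k, Submodule.Quotient.mk q.out = q :=
    fun q => Quotient.out_eq' q
  have hf : Function.Bijective f := by
    constructor
    · rintro ⟨q, ε, σ⟩ ⟨q', ε', σ'⟩ h
      obtain ⟨h1, rfl, rfl⟩ := (compound_eq_compound hd hk).1 h
      rw [← Submodule.Quotient.eq, hout, hout] at h1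
      have h2 : q = q' := h1.symm
      rw [h2]
    · intro φ
      obtain ⟨c, ε, σ, rfl⟩ := exists_eq_compound hd hk φ
      refine ⟨(Submodule.Quotient.mk c, ε, σ), (compound_eq_compound hd hk).2 ⟨?_, rfl, rfl⟩⟩
      rw [← Submodule.Quotient.eq, hout]
  rw [← Nat.card_congr (Equiv.ofBijective f hf), Nat.card_prod, Nat.card_prod,
    Nat.card_eq_fintype_card (α := ℤˣ), Fintype.card_units_int]

end HeawoodTorus

end

theorem mainTheorem11 (d : ℕ) (hd : 2 ≤ d) (k : Fin (d + 1) → ℕ) (hk : ∀ i, 1 ≤ k i)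
    (hne : ∃ i j, k i ≠ k j) :
    Subgroup.closure (Set.range (HeawoodTorus.translation k) ∪ {HeawoodTorus.R k} ∪
        Set.range (HeawoodTorus.shift k)) = (⊤ : Subgroup (HeawoodTorus.Aut k)) ∧
      (Nat.card (HeawoodTorus.Aut k) : ℤ) =
        2 * (Nat.card (HeawoodTorus.shiftStabilizer k) : ℤ) * (HeawoodTorus.M k).det := by
  refine ⟨eq_top_iff.2 fun φ _ => ?_, ?_⟩
  · obtain ⟨c, ε, σ, rfl⟩ := HeawoodTorus.exists_eq_compound hd hk φ
    exact HeawoodTorus.compound_mem_closure k c ε σ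
  · rw [HeawoodTorus.card_aut hd hk, ← HeawoodTorus.card_quotient_rowLattice k]
    push_cast
    ring
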